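/- Let $\Omega$ be a separable Banach space and $\mathbf P$ a centred Gaussian measure on $\Omega$ whose Cameron–Martin space is $\mathcal H=L^2(\mathbb R,H_0)\subset\Omega$ for some real Hilbert space $H_0$. For $h\in\mathcal H$ let $h^*\in L^2(\Omega,\mathbf P)$ be the associated measurable linear functional (the map $h\mapsto h^*$ being the isometry that extends $\iota^*\ell\mapsto\ell$, $\ell\in\Omega^*$, with $\iota\colon\mathcal H\to\Omega$ the inclusion and $\mathcal H$ identified with its dual), and for $t\in[0,1]$ let $\mathcal F_t$ be the $\sigma$-algebra generated by (all versions of) the $h^*$ with $h\in L^2((-\infty,t],H_0)$. Let $X_0\subset H_0$ be a separable Banach space, continuously embedded in $H_0$, let $p\in(2,\infty)$, and let $E=L^p([0,1],X_0)$, viewed as a subset of $\mathcal H$ (and hence of $\Omega$) by extending functions by $0$ outside $[0,1]$. A map $h\colon\Omega\to E$ is called predictable if there is a function $u\colon\Omega\times[0,1]\to X_0$, measurable with respect to the predictable $\sigma$-algebra of the filtration $(\mathcal F_t)_{t\in[0,1]}$, such that for $\mathbf P$-almost every $\omega$ one has $h(\omega)(s)=u(\omega,s)$ for almost every $s\in[0,1]$.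 Let $\mathcal M$ be a complete separable metric space, let $\boldsymbol\xi\colon\Omega\to\mathcal M$ be a ($\mathbf P$-almost everywhere measurable) random variable, and let $\tau\colon E\times\mathcal M\to\mathcal M$ be a (jointly) continuous action of the additive group $E$ on $\mathcal M$. Suppose that for every deterministic $h\in E$ the identity $$\boldsymbol\xi(\omega+h)=\tau(h,\boldsymbol\xi(\omega))$$ holds for $\mathbf P$-almost every $\omega$. Then, for every predictable $h\colon\Omega\to E$ with $\mathbf E\exp(6\|h\|_{\mathcal H}^2)<\infty$, the identity $$\boldsymbol\xi(\omega+h(\omega))=\tau(h(\omega),\boldsymbol\xi(\omega))$$ holds for $\mathbf P$-almost every $\omega$. -/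

import Mathlib

open MeasureTheory ProbabilityTheory Filter Topology
open scoped ENNReal

noncomputable section

/-- The Hilbert space `L²(ℝ, H₀)`. -/
abbrev NoiseSpace (H₀ : Type*) [NormedAddCommGroup H₀] : Type _ :=
  Lp H₀ 2 (volume : Measure ℝ)

/-- The Banach space `Lᵖ([0,1], X₀)` of nice shift directions. -/
abbrev ShiftSpace (X₀ : Type*) [NormedAddCommGroup X₀] (p : ℝ≥0∞) : Type _ :=
  Lp X₀ p (volume.restrict (Set.Icc (0 : ℝ) 1))

section CameronMartin

variable {Ω : Type*} [NormedAddCommGroup Ω] [NormedSpace ℝ Ω] [MeasurableSpace Ω]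
  {H₀ : Type*} [NormedAddCommGroup H₀] [InnerProductSpace ℝ H₀] [CompleteSpace H₀]

/-- `P` is a centred Gaussian measure, and the inclusion `ι` identifies `L²(ℝ, H₀)` with its
Cameron-Martin (reproducing kernel Hilbert) space: `ι` is a continuous injection, and every
continuous linear functional `ℓ` is, under `P`, a centred Gaussian variable whose variance is
`‖ι*ℓ‖²`, the square of the norm of `ℓ` restricted to `L²(ℝ, H₀)`. -/
structure IsCameronMartinInclusion (P : Measure Ω) (ι : NoiseSpace H₀ →L[ℝ] Ω) : Prop where
  isGaussian : IsGaussian P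
  centred : ∀ ℓ : StrongDual ℝ Ω, ∫ ω, ℓ ω ∂P = 0
  injective : Function.Injective ι
  variance_eq : ∀ ℓ : StrongDual ℝ Ω, Var[ℓ; P] = ‖ℓ ∘L ι‖ ^ 2

/-- The Riesz representative `ι*ℓ` in `L²(ℝ, H₀)` of the restriction of `ℓ` to `L²(ℝ, H₀)`. -/
def cmAdjoint (ι : NoiseSpace H₀ →L[ℝ] Ω) (ℓ : StrongDual ℝ Ω) : NoiseSpace H₀ :=
  (InnerProductSpace.toDual ℝ (NoiseSpace H₀)).symm (ℓ ∘L ι)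

/-- `f` is a version of the measurable linear functional `h*` associated with `h ∈ L²(ℝ, H₀)`,
where `h ↦ h*` is the continuous extension of `ι*ℓ ↦ ℓ` to an isometry from `L²(ℝ, H₀)` into
`L²(Ω, P)`. -/
def IsMeasurableFunctional (P : Measure Ω) (ι : NoiseSpace H₀ →L[ℝ] Ω) (h : NoiseSpace H₀)
    (f : Ω → ℝ) : Prop :=
  Measurable f ∧ ∃ ℓ : ℕ → StrongDual ℝ Ω,
    Tendsto (fun n => cmAdjoint ι (ℓ n)) atTop (𝓝 h) ∧
    Tendsto (fun n => eLpNorm (fun ω => f ω - ℓ n ω) 2 P) atTop (𝓝 0)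

/-- The σ-algebra generated by (all versions of) the functionals `h*`, where `h ∈ L²(ℝ, H₀)`
vanishes almost everywhere outside `I`. As `h*` is only defined up to null sets, all its versions
are used; in particular the σ-algebra contains the `P`-null events. -/
@[reducible] def noiseSigma (P : Measure Ω) (ι : NoiseSpace H₀ →L[ℝ] Ω) (I : Set ℝ) : MeasurableSpace Ω :=
  MeasurableSpace.generateFrom
    {A | ∃ (h : NoiseSpace H₀) (f : Ω → ℝ) (B : Set ℝ),
      (∀ᵐ s : ℝ, s ∉ I → h s = 0) ∧ IsMeasurableFunctional P ι h f ∧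
      MeasurableSet B ∧ A = f ⁻¹' B}

theorem noiseSigma_mono (P : Measure Ω) (ι : NoiseSpace H₀ →L[ℝ] Ω) {I J : Set ℝ} (hIJ : I ⊆ J) :
    noiseSigma P ι I ≤ noiseSigma P ι J := by
  apply MeasurableSpace.generateFrom_mono
  rintro A ⟨h, f, B, h0, hf, hB, rfl⟩
  refine ⟨h, f, B, ?_, hf, hB, rfl⟩
  filter_upwards [h0] with s hs hJ
  exact hs fun hI => hJ (hIJ hI)

theorem noiseSigma_le (P : Measure Ω) (ι : NoiseSpace H₀ →L[ℝ] Ω) (I : Set ℝ) :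
    noiseSigma P ι I ≤ ‹MeasurableSpace Ω› := by
  apply MeasurableSpace.generateFrom_le
  rintro A ⟨h, f, B, h0, hf, hB, rfl⟩
  exact hf.1 hB

/-- The filtration `(ℱ_t)`, `ℱ_t = ℱ_{-∞,t}`, for times `t ∈ [0,1]`. -/
def noiseFiltration (P : Measure Ω) (ι : NoiseSpace H₀ →L[ℝ] Ω) :
    Filtration unitInterval ‹MeasurableSpace Ω› where
  seq t := noiseSigma P ι (Set.Iic (t : ℝ))
  mono' _ _ hst := noiseSigma_mono P ι (Set.Iic_subset_Iic.2 hst)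
  le' _ := noiseSigma_le P ι _

/-- The random element `h` of `Lᵖ([0,1], X₀)` is predictable: as a function of `(s, ω)` it agrees,
up to null sets, with a function that is measurable for the predictable σ-algebra. -/
def IsPredictableShift {X₀ : Type*} [NormedAddCommGroup X₀] {p : ℝ≥0∞}
    (P : Measure Ω) (ι : NoiseSpace H₀ →L[ℝ] Ω) (h : Ω → ShiftSpace X₀ p) : Prop :=
  ∃ u : unitInterval → Ω → X₀, IsStronglyPredictable (noiseFiltration P ι) u ∧
    ∀ᵐ ω ∂P, ∀ᵐ s : ℝ, ∀ hs : s ∈ Set.Icc (0 : ℝ) 1, h ω s = u ⟨s, hs⟩ ω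

end CameronMartin

section Inclusion

variable {X₀ H₀ : Type*} [NormedAddCommGroup X₀] [NormedSpace ℝ X₀]
  [NormedAddCommGroup H₀] [NormedSpace ℝ H₀] {p : ℝ≥0∞}

theorem memLp_shift (j : X₀ →L[ℝ] H₀) (hp : 2 ≤ p) (h : ShiftSpace X₀ p) :
    MemLp ((Set.Icc (0 : ℝ) 1).indicator fun s => j (h s)) 2 volume := by
  rw [memLp_indicator_iff_restrict measurableSet_Icc]
  exact j.comp_memLp' ((Lp.memLp h).mono_exponent hp)

/-- The inclusion `Lᵖ([0,1], X₀) ⊂ L²(ℝ, H₀)`, `p ≥ 2`, induced by an inclusion `j` of `X₀` into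
`H₀`: functions are extended by zero outside `[0,1]`. -/
def shiftInclusion (j : X₀ →L[ℝ] H₀) (hp : 2 ≤ p) (h : ShiftSpace X₀ p) : NoiseSpace H₀ :=
  (memLp_shift j hp h).toLp _

end Inclusion

end

/-! The identity for deterministic shifts passes at once to random shifts with finitely many values:
only countably many exceptional null sets arise. A predictable `h` is an almost sure limit of such
shifts `g n`, obtained from step processes (`IsPredictableShift.exists_approx`), and `g n ω +ᵥ ξ ω`
tends to `h ω +ᵥ ξ ω` because the action is continuous. The difficulty is on the other side: `ξ` is
merely measurable, so convergence of the points `T n ω`, where `T n` is the shift of `ω` by `g n ω`,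
does not by itself control `ξ (T n ω)`.

The remedy is that the laws of the `T n` are absolutely continuous with respect to `P`, uniformly in
`n` (`uniformlyAbsolutelyContinuous_shift`). A bounded measurable function can then be replaced by a
continuous one off a set whose preimages under every `T n`, and under their limit, stay small. This
identifies the limit of `ξ (T n ω)` (`UniformlyAbsolutelyContinuous.comp_ae_eq`).

The uniformity comes from Girsanov's formula. On each of its finitely many values, an increment that
lives after time `t k` and depends only on the noise up to `t k` is a Cameron–Martin shift that
leaves the past untouched; induction on the increments gives `lintegral_girsanov`. If the squared
norm of the shift is at most `N`, Cauchy–Schwarz yields P(T ∈ A) ≤ exp(N/2) P(A)^(1/2). Almost sure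
convergence makes the norms tight, so truncating the increments at a large `N` costs a probability
that is small uniformly in `n`. -/

set_option linter.unusedSectionVars false

noncomputable section

/-! ### Measurable functionals and the Cameron–Martin theorem -/

section CameronMartinTheorem

variable {Ω : Type*} [NormedAddCommGroup Ω] [NormedSpace ℝ Ω]
  {H₀ : Type*} [NormedAddCommGroup H₀] [InnerProductSpace ℝ H₀] [CompleteSpace H₀]

theorem cmAdjoint_inner (ι : NoiseSpace H₀ →L[ℝ] Ω) (ℓ : StrongDual ℝ Ω) (k : NoiseSpace H₀) :
    inner ℝ (cmAdjoint ι ℓ) k = ℓ (ι k) := by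
  simp [cmAdjoint]

theorem cmAdjoint_add (ι : NoiseSpace H₀ →L[ℝ] Ω) (ℓ ℓ' : StrongDual ℝ Ω) :
    cmAdjoint ι (ℓ + ℓ') = cmAdjoint ι ℓ + cmAdjoint ι ℓ' :=
  ext_inner_right ℝ fun k => by simp [cmAdjoint_inner, inner_add_left]

theorem cmAdjoint_smul (ι : NoiseSpace H₀ →L[ℝ] Ω) (c : ℝ) (ℓ : StrongDual ℝ Ω) :
    cmAdjoint ι (c • ℓ) = c • cmAdjoint ι ℓ :=
  ext_inner_right ℝ fun k => by simp [cmAdjoint_inner, inner_smul_left]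

theorem cmAdjoint_neg (ι : NoiseSpace H₀ →L[ℝ] Ω) (ℓ : StrongDual ℝ Ω) :
    cmAdjoint ι (-ℓ) = -cmAdjoint ι ℓ :=
  ext_inner_right ℝ fun k => by simp [cmAdjoint_inner]

theorem norm_cmAdjoint (ι : NoiseSpace H₀ →L[ℝ] Ω) (ℓ : StrongDual ℝ Ω) :
    ‖cmAdjoint ι ℓ‖ = ‖ℓ ∘L ι‖ := by
  simp [cmAdjoint]

variable [MeasurableSpace Ω] {P : Measure Ω} {ι : NoiseSpace H₀ →L[ℝ] Ω}

theorem IsMeasurableFunctional.exists_seq_ae [BorelSpace Ω] [IsFiniteMeasure P]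
    {g : NoiseSpace H₀} {f : Ω → ℝ}
    (hf : IsMeasurableFunctional P ι g f) :
    ∃ ℓ : ℕ → StrongDual ℝ Ω, Tendsto (fun n => cmAdjoint ι (ℓ n)) atTop (𝓝 g) ∧
      ∀ᵐ ω ∂P, Tendsto (fun n => ℓ n ω) atTop (𝓝 (f ω)) := by
  obtain ⟨hm, ℓ, h1, h2⟩ := hf
  have h3 : TendstoInMeasure P (fun n ω => ℓ n ω) atTop f := by
    refine tendstoInMeasure_of_tendsto_eLpNorm (p := 2) (by simp)
      (fun n => (ℓ n).continuous.measurable.aestronglyMeasurable) hm.aestronglyMeasurable ?_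
    refine h2.congr fun n => ?_
    exact eLpNorm_sub_comm f (fun ω => ℓ n ω) 2 P
  obtain ⟨ns, hns, h4⟩ := h3.exists_seq_tendsto_ae
  exact ⟨fun n => ℓ (ns n), h1.comp hns.tendsto_atTop, h4⟩

theorem IsCameronMartinInclusion.integral_cexp_dual [BorelSpace Ω]
    (hι : IsCameronMartinInclusion P ι) (ℓ : StrongDual ℝ Ω) :
    ∫ ω, Complex.exp (ℓ ω * Complex.I) ∂P =
      Complex.exp (-(‖cmAdjoint ι ℓ‖ ^ 2 : ℝ) / 2) := by
  have := hι.isGaussian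
  have h := IsGaussian.charFunDual_eq (μ := P) ℓ
  rw [charFunDual_apply] at h
  rw [h, integral_complex_ofReal, hι.centred, hι.variance_eq, norm_cmAdjoint]
  simp [neg_div]

/-- The characteristic function of the pair formed by a continuous functional and a measurable
functional. -/
theorem IsCameronMartinInclusion.integral_cexp [BorelSpace Ω]
    (hι : IsCameronMartinInclusion P ι) {g : NoiseSpace H₀} {f : Ω → ℝ}
    (hf : IsMeasurableFunctional P ι g f) (ℓ : StrongDual ℝ Ω) (b : ℝ) :
    ∫ ω, Complex.exp ((ℓ ω + b * f ω : ℝ) * Complex.I) ∂P =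
      Complex.exp (-(‖cmAdjoint ι ℓ + b • g‖ ^ 2 : ℝ) / 2) := by
  have := hι.isGaussian
  obtain ⟨ℓ', h1, h2⟩ := hf.exists_seq_ae
  have hlim : Tendsto (fun n => ∫ ω, Complex.exp (((ℓ + b • ℓ' n) ω : ℝ) * Complex.I) ∂P) atTop
      (𝓝 (∫ ω, Complex.exp ((ℓ ω + b * f ω : ℝ) * Complex.I) ∂P)) := by
    refine tendsto_integral_of_dominated_convergence (fun _ => 1) (fun n => ?_)
      (integrable_const _) (fun n => ?_) ?_
    · refine Continuous.aestronglyMeasurable ?_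
      fun_prop
    · exact .of_forall fun ω => (Complex.norm_exp_ofReal_mul_I _).le
    · filter_upwards [h2] with ω hω
      have : Tendsto (fun n => (ℓ + b • ℓ' n) ω) atTop (𝓝 (ℓ ω + b * f ω)) :=
        (hω.const_mul b).const_add (ℓ ω)
      exact ((Complex.continuous_exp.comp
        (Complex.continuous_ofReal.mul continuous_const)).tendsto _).comp this
  refine tendsto_nhds_unique hlim ?_
  simp_rw [hι.integral_cexp_dual, cmAdjoint_add, cmAdjoint_smul]
  have hc : Continuous fun k : NoiseSpace H₀ =>
      Complex.exp (-(‖cmAdjoint ι ℓ + b • k‖ ^ 2 : ℝ) / 2) := by fun_prop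
  exact (hc.tendsto g).comp h1

theorem IsCameronMartinInclusion.map_eq_gaussianReal [BorelSpace Ω]
    (hι : IsCameronMartinInclusion P ι) {g : NoiseSpace H₀} {f : Ω → ℝ}
    (hf : IsMeasurableFunctional P ι g f) :
    P.map f = gaussianReal 0 (‖g‖₊ ^ 2) := by
  have := hι.isGaussian
  have := Measure.isProbabilityMeasure_map (μ := P) hf.1.aemeasurable
  refine Measure.ext_of_charFun (funext fun t => ?_)
  rw [charFun_gaussianReal, charFun_apply_real, integral_map hf.1.aemeasurable (by fun_prop)]
  have h := hι.integral_cexp hf 0 t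
  have h0 : cmAdjoint ι 0 = 0 := by simpa using cmAdjoint_smul ι 0 0
  simp only [zero_apply, zero_add, h0, norm_smul] at h
  push_cast at h ⊢
  rw [h]
  congr 1
  have ht : (‖t‖ : ℂ) ^ 2 = (t : ℂ) ^ 2 := by
    rw [← Complex.ofReal_pow, Real.norm_eq_abs, sq_abs, Complex.ofReal_pow]
  rw [mul_pow, ht]
  ring

/-- With r = ι*ℓ - c g orthogonal to g, Pythagoras splits the quadratic exponent of the joint
characteristic function, which therefore factorizes. -/
theorem IsCameronMartinInclusion.indepFun_residual [BorelSpace Ω]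
    (hι : IsCameronMartinInclusion P ι) {g : NoiseSpace H₀} {f : Ω → ℝ}
    (hf : IsMeasurableFunctional P ι g f) (ℓ : StrongDual ℝ Ω) (c : ℝ)
    (hc : inner ℝ (cmAdjoint ι ℓ - c • g) g = 0) :
    IndepFun (fun ω => ℓ ω - c * f ω) f P := by
  have := hι.isGaussian
  have hfm := hf.1
  have hr : Measurable fun ω => ℓ ω - c * f ω := by
    have := ℓ.continuous.measurable
    fun_prop
  rw [indepFun_iff_charFun_prod hr.aemeasurable hfm.aemeasurable]
  intro t
  rw [charFun_apply_real, charFun_apply_real, charFun_apply,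
    integral_map (by fun_prop) (by fun_prop), integral_map hr.aemeasurable (by fun_prop),
    integral_map hfm.aemeasurable (by fun_prop)]
  have e1 := hι.integral_cexp hf (t.ofLp.1 • ℓ) (t.ofLp.2 - t.ofLp.1 * c)
  have e2 := hι.integral_cexp hf (t.ofLp.1 • ℓ) (- (t.ofLp.1 * c))
  have e3 := hι.integral_cexp hf 0 t.ofLp.2
  have h0 : cmAdjoint ι 0 = 0 := by simpa using cmAdjoint_smul ι 0 0
  set r := cmAdjoint ι ℓ - c • g with hrdef
  have f1 : cmAdjoint ι (t.ofLp.1 • ℓ) + (t.ofLp.2 - t.ofLp.1 * c) • g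
      = t.ofLp.1 • r + t.ofLp.2 • g := by rw [cmAdjoint_smul, hrdef]; module
  have f2 : cmAdjoint ι (t.ofLp.1 • ℓ) + (-(t.ofLp.1 * c)) • g = t.ofLp.1 • r := by
    rw [cmAdjoint_smul, hrdef]; module
  have f3 : ‖t.ofLp.1 • r + t.ofLp.2 • g‖ ^ 2 = ‖t.ofLp.1 • r‖ ^ 2 + ‖t.ofLp.2 • g‖ ^ 2 := by
    rw [norm_add_sq_real, inner_smul_left, inner_smul_right, hc]; simp
  rw [f1, f3] at e1
  rw [f2] at e2
  rw [h0, zero_add] at e3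
  have hprod : Complex.exp (-(‖t.ofLp.1 • r‖ ^ 2 + ‖t.ofLp.2 • g‖ ^ 2 : ℝ) / 2)
      = Complex.exp (-(‖t.ofLp.1 • r‖ ^ 2 : ℝ) / 2) * Complex.exp (-(‖t.ofLp.2 • g‖ ^ 2 : ℝ) / 2) := by
    rw [← Complex.exp_add]; congr 1; push_cast; ring
  rw [hprod, ← e2, ← e3] at e1
  convert e1 using 1
  · congr 1; ext ω; congr 2
    simp [WithLp.prod_inner_apply]; ring
  · congr 1
    · congr 1; ext ω; congr 1; simp; ring
    · congr 1; ext ω; congr 1; simp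

theorem IsCameronMartinInclusion.integrable_exp [BorelSpace Ω]
    (hι : IsCameronMartinInclusion P ι) {g : NoiseSpace H₀} {f : Ω → ℝ}
    (hf : IsMeasurableFunctional P ι g f) : Integrable (fun ω => Real.exp (f ω)) P := by
  have h : Integrable (fun x => Real.exp (1 * x)) (P.map f) := by
    rw [hι.map_eq_gaussianReal hf]
    exact integrable_exp_mul_gaussianReal 1
  simpa [Function.comp_def] using h.comp_measurable hf.1

/-- Projecting `ℓ` onto `f` leaves an independent residual. The integral is then the characteristic
function of the residual times the complex moment generating function of `f` at 1 + ci. -/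
theorem IsCameronMartinInclusion.integral_cexp_mul_exp [BorelSpace Ω]
    (hι : IsCameronMartinInclusion P ι) {g : NoiseSpace H₀} {f : Ω → ℝ}
    (hf : IsMeasurableFunctional P ι g f) (ℓ : StrongDual ℝ Ω) :
    ∫ ω, Complex.exp (ℓ ω * Complex.I) * Complex.exp (f ω) ∂P =
      Complex.exp (ℓ (ι g) * Complex.I) * Complex.exp (-(‖cmAdjoint ι ℓ‖ ^ 2 : ℝ) / 2) *
        Complex.exp ((‖g‖ ^ 2 : ℝ) / 2) := by
  have := hι.isGaussian
  have hfm := hf.1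
  have hℓ := ℓ.continuous.measurable
  obtain ⟨c, hc⟩ : ∃ c : ℝ, c * ‖g‖ ^ 2 = ℓ (ι g) := by
    rcases eq_or_ne g 0 with rfl | hg
    · exact ⟨0, by simp⟩
    · exact ⟨ℓ (ι g) / ‖g‖ ^ 2, by
        have := norm_ne_zero_iff.2 hg
        field_simp⟩
  have horth : inner ℝ (cmAdjoint ι ℓ - c • g) g = 0 := by
    rw [inner_sub_left, cmAdjoint_inner, inner_smul_left, real_inner_self_eq_norm_sq, ← hc]; simp
  have hind := hι.indepFun_residual hf ℓ c horth
  have hcomp := hind.comp (φ := fun x : ℝ => Complex.exp (x * Complex.I))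
    (ψ := fun x : ℝ => Complex.exp ((1 + c * Complex.I) * x)) (by fun_prop) (by fun_prop)
  have hmul := hcomp.integral_fun_mul_eq_mul_integral
    (Measurable.aestronglyMeasurable (by simp only [Function.comp_def]; fun_prop))
    (Measurable.aestronglyMeasurable (by simp only [Function.comp_def]; fun_prop))
  simp only [Function.comp_apply] at hmul
  have e1 : ∫ ω, Complex.exp (ℓ ω * Complex.I) * Complex.exp (f ω) ∂P =
      ∫ ω, Complex.exp ((ℓ ω - c * f ω : ℝ) * Complex.I) *
        Complex.exp ((1 + c * Complex.I) * f ω) ∂P := by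
    congr 1; ext ω
    rw [← Complex.exp_add, ← Complex.exp_add]; congr 1; push_cast; ring
  have e2 : ∫ ω, Complex.exp ((ℓ ω - c * f ω : ℝ) * Complex.I) ∂P =
      Complex.exp (-(‖cmAdjoint ι ℓ - c • g‖ ^ 2 : ℝ) / 2) := by
    have := hι.integral_cexp hf ℓ (-c)
    simpa [sub_eq_add_neg] using this
  have e3 := complexMGF_gaussianReal (hι.map_eq_gaussianReal hf) (1 + c * Complex.I)
  rw [complexMGF] at e3
  have e4 : ‖cmAdjoint ι ℓ - c • g‖ ^ 2 = ‖cmAdjoint ι ℓ‖ ^ 2 - c ^ 2 * ‖g‖ ^ 2 := by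
    rw [norm_sub_sq_real, inner_smul_right, cmAdjoint_inner, ← hc, norm_smul, mul_pow,
      Real.norm_eq_abs, sq_abs]
    ring
  rw [e1, hmul, e2, e3, e4, ← Complex.exp_add, ← Complex.exp_add, ← Complex.exp_add, ← hc]
  congr 1
  push_cast
  linear_combination (‖g‖ ^ 2 * c ^ 2 / 2 : ℂ) * Complex.I_sq

variable [BorelSpace Ω] [CompleteSpace Ω] [TopologicalSpace.SeparableSpace Ω]

/-- The Cameron-Martin theorem. -/
theorem IsCameronMartinInclusion.map_add_eq_withDensity
    (hι : IsCameronMartinInclusion P ι) {g : NoiseSpace H₀} {f : Ω → ℝ}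
    (hf : IsMeasurableFunctional P ι g f) :
    P.map (fun ω => ω + ι g) =
      P.withDensity fun ω => ENNReal.ofReal (Real.exp (f ω - ‖g‖ ^ 2 / 2)) := by
  have := hι.isGaussian
  have : SecondCountableTopology Ω := UniformSpace.secondCountable_of_separable Ω
  have hfm := hf.1
  have hint : Integrable (fun ω => Real.exp (f ω - ‖g‖ ^ 2 / 2)) P := by
    simp_rw [Real.exp_sub]
    exact (hι.integrable_exp hf).div_const _
  have := isFiniteMeasure_withDensity_ofReal hint.2
  refine Measure.ext_of_charFunDual (funext fun ℓ => ?_)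
  have hshift : Measurable fun ω => ω + ι g := by fun_prop
  rw [charFunDual_apply, charFunDual_apply, integral_map hshift.aemeasurable
    (Continuous.aestronglyMeasurable (by fun_prop)),
    integral_withDensity_eq_integral_toReal_smul (by fun_prop) (by simp)]
  have e1 : ∀ ω, (ENNReal.ofReal (Real.exp (f ω - ‖g‖ ^ 2 / 2))).toReal •
      Complex.exp (ℓ ω * Complex.I) = Complex.exp (ℓ ω * Complex.I) * Complex.exp (f ω) *
        Complex.exp (-(‖g‖ ^ 2 : ℝ) / 2) := by
    intro ω
    rw [ENNReal.toReal_ofReal (Real.exp_pos _).le, Complex.real_smul, mul_assoc,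
      ← Complex.exp_add, mul_comm, Complex.ofReal_exp]
    congr 2
    push_cast
    ring
  have e2 : ∀ ω, Complex.exp (ℓ (ω + ι g) * Complex.I) =
      Complex.exp (ℓ ω * Complex.I) * Complex.exp (ℓ (ι g) * Complex.I) := by
    intro ω
    rw [← Complex.exp_add, map_add]; congr 1; push_cast; ring
  simp_rw [e1, e2]
  rw [integral_mul_const, integral_mul_const, hι.integral_cexp_dual,
    hι.integral_cexp_mul_exp hf, mul_assoc _ _ (Complex.exp (-(‖g‖ ^ 2 : ℝ) / 2)),
    ← Complex.exp_add _ (-(‖g‖ ^ 2 : ℝ) / 2 : ℂ), neg_div _ ((‖g‖ ^ 2 : ℝ) : ℂ), add_neg_cancel,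
    Complex.exp_zero, mul_one, mul_comm]

theorem IsCameronMartinInclusion.eLpNorm_dual
    (hι : IsCameronMartinInclusion P ι) (ℓ : StrongDual ℝ Ω) :
    eLpNorm ℓ 2 P = ENNReal.ofReal ‖cmAdjoint ι ℓ‖ := by
  have := hι.isGaussian
  have : SecondCountableTopology Ω := UniformSpace.secondCountable_of_separable Ω
  have hmem : MemLp ℓ 2 P := IsGaussian.memLp_dual P ℓ 2 (by simp)
  have hv := hι.variance_eq ℓ
  rw [← norm_cmAdjoint, variance_of_integral_eq_zero hmem.aestronglyMeasurable.aemeasurable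
    (hι.centred ℓ)] at hv
  rw [hmem.eLpNorm_eq_integral_rpow_norm (by simp) (by simp)]
  congr 1
  simp only [ENNReal.toReal_ofNat, Real.rpow_ofNat, Real.norm_eq_abs, sq_abs]
  rw [hv, ← one_div, ← Real.sqrt_eq_rpow, Real.sqrt_sq (norm_nonneg _)]

/-- A vector `v` orthogonal to the range has `ℓ (ι v) = 0` for every `ℓ`, hence `ι v = 0` by
Hahn–Banach, and `v = 0` by injectivity. -/
theorem IsCameronMartinInclusion.denseRange_cmAdjoint
    (hι : IsCameronMartinInclusion P ι) : DenseRange (cmAdjoint ι) := by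
  let L : StrongDual ℝ Ω →ₗ[ℝ] NoiseSpace H₀ :=
    { toFun := cmAdjoint ι, map_add' := cmAdjoint_add ι, map_smul' := cmAdjoint_smul ι }
  have h : (LinearMap.range L).topologicalClosure = ⊤ := by
    rw [Submodule.topologicalClosure_eq_top_iff, Submodule.eq_bot_iff]
    intro v hv
    refine hι.injective ?_
    rw [map_zero]
    refine SeparatingDual.eq_zero_of_forall_dual_eq_zero (R := ℝ) fun ℓ => ?_
    rw [← cmAdjoint_inner]
    exact (Submodule.mem_orthogonal _ _).1 hv _ ⟨ℓ, rfl⟩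
  exact Submodule.dense_iff_topologicalClosure_eq_top.2 h

theorem IsCameronMartinInclusion.exists_isMeasurableFunctional
    (hι : IsCameronMartinInclusion P ι) (g : NoiseSpace H₀) :
    ∃ f, IsMeasurableFunctional P ι g f := by
  have := hι.isGaussian
  have : SecondCountableTopology Ω := UniformSpace.secondCountable_of_separable Ω
  obtain ⟨x, hx, hxg⟩ := mem_closure_iff_seq_limit.1 (hι.denseRange_cmAdjoint g)
  choose ℓ hℓ using hx
  obtain rfl : (fun n => cmAdjoint ι (ℓ n)) = x := funext hℓ
  have hmem : ∀ ℓ : StrongDual ℝ Ω, MemLp ℓ 2 P := fun ℓ => IsGaussian.memLp_dual P ℓ 2 (by simp)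
  -- The isometry property: convergence of the representatives makes the functionals Cauchy in L².
  have hdist : ∀ m n, dist ((hmem (ℓ m)).toLp) ((hmem (ℓ n)).toLp) =
      dist (cmAdjoint ι (ℓ m)) (cmAdjoint ι (ℓ n)) := by
    intro m n
    rw [dist_eq_norm, dist_eq_norm, ← MemLp.toLp_sub, Lp.norm_toLp, ← FunLike.coe_sub,
      hι.eLpNorm_dual, ENNReal.toReal_ofReal (norm_nonneg _)]
    congr 1
    rw [sub_eq_add_neg, sub_eq_add_neg, ← neg_one_smul ℝ (ℓ n), cmAdjoint_add, cmAdjoint_smul,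
      neg_one_smul]
  have hcauchy : CauchySeq fun n => (hmem (ℓ n)).toLp := by
    rw [Metric.cauchySeq_iff]
    simp_rw [hdist]
    exact Metric.cauchySeq_iff.1 hxg.cauchySeq
  obtain ⟨G, hG⟩ := cauchySeq_tendsto_of_complete hcauchy
  refine ⟨G, (Lp.stronglyMeasurable G).measurable, ℓ, hxg, ?_⟩
  have h := (tendsto_iff_edist_tendsto_0.1 hG)
  refine h.congr fun n => ?_
  rw [edist_comm, Lp.edist_def]
  refine eLpNorm_congr_ae ?_
  filter_upwards [(hmem (ℓ n)).coeFn_toLp] with ω hω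
  simp [hω]

theorem IsCameronMartinInclusion.ae_shift (hι : IsCameronMartinInclusion P ι) (k : NoiseSpace H₀)
    {q : Ω → Prop} (hq : ∀ᵐ ω ∂P, q ω) : ∀ᵐ ω ∂P, q (ω + ι k) := by
  obtain ⟨f, hf⟩ := hι.exists_isMeasurableFunctional k
  have : SecondCountableTopology Ω := UniformSpace.secondCountable_of_separable Ω
  have hac : P.map (fun ω => ω + ι k) ≪ P := by
    rw [hι.map_add_eq_withDensity hf]
    exact withDensity_absolutelyContinuous _ _
  exact ae_of_ae_map (by fun_prop) (hac.ae_le hq)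

/-- The Cameron-Martin formula for nonnegative functions. -/
theorem IsCameronMartinInclusion.lintegral_shift
    (hι : IsCameronMartinInclusion P ι) {g : NoiseSpace H₀} {f : Ω → ℝ}
    (hf : IsMeasurableFunctional P ι g f) {G : Ω → ℝ≥0∞} (hG : Measurable G) :
    ∫⁻ ω, G (ω + ι g) ∂P = ∫⁻ ω, ENNReal.ofReal (Real.exp (f ω - ‖g‖ ^ 2 / 2)) * G ω ∂P := by
  have : SecondCountableTopology Ω := UniformSpace.secondCountable_of_separable Ω
  have hfm := hf.1
  rw [← lintegral_map hG (by fun_prop), hι.map_add_eq_withDensity hf,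
    lintegral_withDensity_eq_lintegral_mul _ (by fun_prop) hG]
  rfl

theorem IsMeasurableFunctional.neg {g : NoiseSpace H₀} {f : Ω → ℝ}
    (hf : IsMeasurableFunctional P ι g f) : IsMeasurableFunctional P ι (-g) (-f) := by
  obtain ⟨hm, ℓ, h1, h2⟩ := hf
  refine ⟨hm.neg, fun n => -ℓ n, ?_, ?_⟩
  · refine h1.neg.congr fun n => ?_
    exact (cmAdjoint_neg ι (ℓ n)).symm
  · refine h2.congr fun n => ?_
    rw [← eLpNorm_neg]
    congr 1
    ext ω
    simp; ring

/-- For continuous functionals this is linearity. The limit may be taken at the shifted point as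
well, since shifts by Cameron–Martin vectors preserve null sets. -/
theorem IsCameronMartinInclusion.shift_apply_ae (hι : IsCameronMartinInclusion P ι)
    {g : NoiseSpace H₀} {f : Ω → ℝ} (hf : IsMeasurableFunctional P ι g f) (k : NoiseSpace H₀) :
    ∀ᵐ ω ∂P, f (ω + ι k) = f ω + inner ℝ g k := by
  have := hι.isGaussian
  obtain ⟨ℓ, h1, h2⟩ := hf.exists_seq_ae
  filter_upwards [h2, hι.ae_shift k h2] with ω ha hb
  refine tendsto_nhds_unique hb ?_
  simp_rw [map_add, ← cmAdjoint_inner]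
  exact ha.add (h1.inner tendsto_const_nhds)

/-- An event that is measurable for the noise in `I` is, up to null sets, invariant under shifts
that vanish on `I`. -/
theorem IsCameronMartinInclusion.mem_shift_iff_ae (hι : IsCameronMartinInclusion P ι)
    {I : Set ℝ} {A : Set Ω} (hA : MeasurableSet[noiseSigma P ι I] A) {v : NoiseSpace H₀}
    (hv : ∀ᵐ s : ℝ, s ∈ I → v s = 0) : ∀ᵐ ω ∂P, ω + ι v ∈ A ↔ ω ∈ A := by
  induction A, hA using MeasurableSpace.generateFrom_induction with
  | hC A hA _ =>
    obtain ⟨h, f, B, h0, hf, hB, rfl⟩ := hA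
    have horth : inner ℝ h v = 0 := by
      rw [L2.inner_def]
      refine integral_eq_zero_of_ae ?_
      filter_upwards [h0, hv] with s h1 h2
      by_cases hs : s ∈ I
      · simp [h2 hs]
      · simp [h1 hs]
    filter_upwards [hι.shift_apply_ae hf v] with ω hω
    simp [hω, horth]
  | empty => simp
  | compl A _ ih =>
    filter_upwards [ih] with ω hω
    simp [hω]
  | iUnion A _ ih =>
    filter_upwards [ae_all_iff.2 ih] with ω hω
    simp [hω]

end CameronMartinTheorem

/-! ### Random variables with finitely many values, and truncation -/

section FiniteRange

/-- A function with finite range all of whose fibres are measurable can be substituted into a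
family of measurable functions. -/
theorem measurable_apply_of_finite_range {Ω α β : Type*} {m : MeasurableSpace Ω}
    [MeasurableSpace β] {φ : Ω → α} (hfin : (Set.range φ).Finite)
    (hφ : ∀ B : Set α, MeasurableSet (φ ⁻¹' B)) {g : α → Ω → β} (hg : ∀ a, Measurable (g a)) :
    Measurable fun ω => g (φ ω) ω := by
  intro C hC
  have : (fun ω => g (φ ω) ω) ⁻¹' C = ⋃ a ∈ Set.range φ, φ ⁻¹' {a} ∩ g a ⁻¹' C := by
    ext ω
    simp only [Set.mem_preimage, Set.mem_iUnion, Set.mem_inter_iff, Set.mem_singleton_iff,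
      exists_prop]
    exact ⟨fun h => ⟨φ ω, ⟨ω, rfl⟩, rfl, h⟩, fun ⟨a, _, h1, h2⟩ => h1 ▸ h2⟩
  rw [this]
  exact hfin.measurableSet_biUnion fun a _ => (hφ {a}).inter (hg a hC)

variable {Ω E : Type*} [NormedAddCommGroup E]

/-- The increments, set to zero once the sum of their squared norms exceeds `N`. -/
def truncate (Φ : ℕ → Ω → E) (N : ℝ) (k : ℕ) (ω : Ω) : E :=
  open Classical in if ∑ i ∈ Finset.range (k + 1), ‖Φ i ω‖ ^ 2 ≤ N then Φ k ω else 0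

theorem truncate_eq_or (Φ : ℕ → Ω → E) (N : ℝ) (k : ℕ) (ω : Ω) :
    truncate Φ N k ω = Φ k ω ∨ truncate Φ N k ω = 0 := by
  unfold truncate
  split_ifs <;> simp

theorem measurableSet_truncate_preimage {m : MeasurableSpace Ω} {Φ : ℕ → Ω → E} (k : ℕ)
    (hfin : ∀ i, (Set.range (Φ i)).Finite)
    (hΦ : ∀ i ≤ k, ∀ B : Set E, MeasurableSet (Φ i ⁻¹' B)) (N : ℝ) (B : Set E) :
    MeasurableSet (truncate Φ N k ⁻¹' B) := by
  have hC : MeasurableSet {ω | ∑ i ∈ Finset.range (k + 1), ‖Φ i ω‖ ^ 2 ≤ N} := by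
    refine measurableSet_le (Finset.measurable_fun_sum _ fun i hi => ?_) measurable_const
    exact measurable_apply_of_finite_range (hfin i) (hΦ i (Finset.mem_range_succ_iff.1 hi))
      (g := fun a _ => ‖a‖ ^ 2) fun a => measurable_const
  have : truncate Φ N k ⁻¹' B =
      ({ω | ∑ i ∈ Finset.range (k + 1), ‖Φ i ω‖ ^ 2 ≤ N} ∩ Φ k ⁻¹' B) ∪
      ({ω | ∑ i ∈ Finset.range (k + 1), ‖Φ i ω‖ ^ 2 ≤ N}ᶜ ∩ {_ω | (0 : E) ∈ B}) := by
    ext ω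
    by_cases h : ∑ i ∈ Finset.range (k + 1), ‖Φ i ω‖ ^ 2 ≤ N <;> simp [truncate, h]
  rw [this]
  exact (hC.inter (hΦ k le_rfl B)).union (hC.compl.inter (MeasurableSet.const _))

/-- The cut-off at `k` already counts the `k`-th increment, so the bound is never overshot; beyond
it everything vanishes. -/
theorem sum_norm_truncate_le (Φ : ℕ → Ω → E) {N : ℝ} (hN : 0 ≤ N) (n : ℕ) (ω : Ω) :
    ∑ k ∈ Finset.range n, ‖truncate Φ N k ω‖ ^ 2 ≤ N := by
  have hle : ∀ n, ∑ k ∈ Finset.range n, ‖truncate Φ N k ω‖ ^ 2 ≤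
      ∑ k ∈ Finset.range n, ‖Φ k ω‖ ^ 2 := fun n => Finset.sum_le_sum fun k _ => by
    rcases truncate_eq_or Φ N k ω with h | h <;> simp [h]
  induction n with
  | zero => simpa
  | succ n ih =>
    by_cases h : ∑ i ∈ Finset.range (n + 1), ‖Φ i ω‖ ^ 2 ≤ N
    · exact (hle _).trans h
    · rw [Finset.sum_range_succ, truncate, if_neg h]
      simpa using ih

theorem sum_truncate_eq (Φ : ℕ → Ω → E) {N : ℝ} {n : ℕ} {ω : Ω}
    (h : ∑ k ∈ Finset.range n, ‖Φ k ω‖ ^ 2 ≤ N) :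
    ∑ k ∈ Finset.range n, truncate Φ N k ω = ∑ k ∈ Finset.range n, Φ k ω := by
  refine Finset.sum_congr rfl fun k hk => if_pos (le_trans ?_ h)
  exact Finset.sum_le_sum_of_subset_of_nonneg
    (Finset.range_mono (Nat.succ_le_of_lt (Finset.mem_range.1 hk))) fun _ _ _ => by positivity

end FiniteRange

/-! ### Girsanov's formula for adapted increments -/

section Girsanov

variable {Ω : Type*} [NormedAddCommGroup Ω] [NormedSpace ℝ Ω]
  {H₀ : Type*} [NormedAddCommGroup H₀] [InnerProductSpace ℝ H₀] [CompleteSpace H₀]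
  [MeasurableSpace Ω] {P : Measure Ω} {ι : NoiseSpace H₀ →L[ℝ] Ω}

/-- A sequence of finitely valued random increments, the `k`-th of which is supported in the time
interval `(t k, t (k + 1)]` and only depends on the noise up to time `t k`. -/
structure IsAdaptedIncrements (P : Measure Ω) (ι : NoiseSpace H₀ →L[ℝ] Ω) (t : ℕ → ℝ)
    (Φ : ℕ → Ω → NoiseSpace H₀) : Prop where
  mono : Monotone t
  finite : ∀ k, (Set.range (Φ k)).Finite
  meas : ∀ k B, MeasurableSet[noiseSigma P ι (Set.Iic (t k))] (Φ k ⁻¹' B)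
  past : ∀ k ω, ∀ᵐ s : ℝ, s ∈ Set.Iic (t k) → Φ k ω s = 0
  future : ∀ k ω, ∀ᵐ s : ℝ, t (k + 1) < s → Φ k ω s = 0

namespace IsAdaptedIncrements

variable {t : ℕ → ℝ} {Φ : ℕ → Ω → NoiseSpace H₀}

/-- The supports are disjoint: `Φ k` vanishes after `t (k + 1) ≤ t n`, and `v` vanishes up to `t n`.
-/
theorem inner_eq_zero (hΦ : IsAdaptedIncrements P ι t Φ) {k n : ℕ} (hkn : k < n) (ω : Ω)
    {v : NoiseSpace H₀} (hv : ∀ᵐ s : ℝ, s ∈ Set.Iic (t n) → v s = 0) :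
    inner ℝ (Φ k ω) v = 0 := by
  rw [L2.inner_def]
  refine integral_eq_zero_of_ae ?_
  filter_upwards [hΦ.future k ω, hv] with s h1 h2
  by_cases hs : s ≤ t n
  · simp [h2 hs]
  · simp [h1 ((hΦ.mono (Nat.succ_le_of_lt hkn)).trans_lt (not_le.1 hs))]

theorem norm_sum_sq (hΦ : IsAdaptedIncrements P ι t Φ) (n : ℕ) (ω : Ω) :
    ‖∑ k ∈ Finset.range n, Φ k ω‖ ^ 2 = ∑ k ∈ Finset.range n, ‖Φ k ω‖ ^ 2 := by
  induction n with
  | zero => simp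
  | succ n ih =>
    rw [Finset.sum_range_succ, Finset.sum_range_succ, norm_add_sq_real, ih, sum_inner,
      Finset.sum_eq_zero fun k hk => hΦ.inner_eq_zero (Finset.mem_range.1 hk) ω (hΦ.past n ω)]
    simp

theorem measurableSet_preimage (hΦ : IsAdaptedIncrements P ι t Φ) (k : ℕ)
    (B : Set (NoiseSpace H₀)) : MeasurableSet (Φ k ⁻¹' B) :=
  noiseSigma_le P ι _ _ (hΦ.meas k B)

theorem measurable_apply (hΦ : IsAdaptedIncrements P ι t Φ) (k : ℕ) {β : Type*}
    [MeasurableSpace β] {g : NoiseSpace H₀ → Ω → β} (hg : ∀ a, Measurable (g a)) :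
    Measurable fun ω => g (Φ k ω) ω :=
  measurable_apply_of_finite_range (hΦ.finite k) (hΦ.measurableSet_preimage k) hg

theorem neg (hΦ : IsAdaptedIncrements P ι t Φ) : IsAdaptedIncrements P ι t (fun k ω => -Φ k ω) where
  mono := hΦ.mono
  finite k := by
    refine ((hΦ.finite k).image (fun x => -x)).subset ?_
    rintro _ ⟨ω, rfl⟩
    exact ⟨_, ⟨ω, rfl⟩, rfl⟩
  meas k B := hΦ.meas k ((fun x => -x) ⁻¹' B)
  past k ω := by
    filter_upwards [hΦ.past k ω, Lp.coeFn_neg (Φ k ω)] with s h1 h2 hs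
    rw [h2, Pi.neg_apply, h1 hs, neg_zero]
  future k ω := by
    filter_upwards [hΦ.future k ω, Lp.coeFn_neg (Φ k ω)] with s h1 h2 hs
    rw [h2, Pi.neg_apply, h1 hs, neg_zero]

/-- Adaptedness survives because the cut-off at `k` only looks at increments up to `k`, all of them
known at time `t k`. -/
theorem truncated (hΦ : IsAdaptedIncrements P ι t Φ) (N : ℝ) :
    IsAdaptedIncrements P ι t (truncate Φ N) where
  mono := hΦ.mono
  finite k := by
    refine ((hΦ.finite k).insert 0).subset ?_
    rintro _ ⟨ω, rfl⟩
    rcases truncate_eq_or Φ N k ω with h | h <;> simp [h]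
  meas k B := measurableSet_truncate_preimage k hΦ.finite (fun i hi B =>
    noiseSigma_mono P ι (Set.Iic_subset_Iic.2 (hΦ.mono hi)) _ (hΦ.meas i B)) N B
  past k ω := by
    rcases truncate_eq_or Φ N k ω with h | h
    · rw [h]; exact hΦ.past k ω
    · rw [h]; filter_upwards [Lp.coeFn_zero H₀ 2 volume] with s hs _ using hs
  future k ω := by
    rcases truncate_eq_or Φ N k ω with h | h
    · rw [h]; exact hΦ.future k ω
    · rw [h]; filter_upwards [Lp.coeFn_zero H₀ 2 volume] with s hs _ using hs

variable [BorelSpace Ω] [CompleteSpace Ω] [TopologicalSpace.SeparableSpace Ω]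

theorem apply_shift_ae (hΦ : IsAdaptedIncrements P ι t Φ) (hι : IsCameronMartinInclusion P ι)
    {k n : ℕ} (hkn : k ≤ n) {v : NoiseSpace H₀}
    (hv : ∀ᵐ s : ℝ, s ∈ Set.Iic (t n) → v s = 0) : ∀ᵐ ω ∂P, Φ k (ω + ι v) = Φ k ω := by
  have hv' : ∀ᵐ s : ℝ, s ∈ Set.Iic (t k) → v s = 0 := by
    filter_upwards [hv] with s hs h
    exact hs (le_trans h (hΦ.mono hkn))
  have h := (ae_ball_iff (hΦ.finite k).countable).2 fun a _ =>
    hι.mem_shift_iff_ae (hΦ.meas k {a}) hv'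
  filter_upwards [h] with ω hω
  exact (hω _ ⟨ω, rfl⟩).2 rfl

variable {W : NoiseSpace H₀ → Ω → ℝ}

theorem functional_shift_ae (hΦ : IsAdaptedIncrements P ι t Φ)
    (hι : IsCameronMartinInclusion P ι) (hW : ∀ g, IsMeasurableFunctional P ι g (W g))
    {k n : ℕ} (hkn : k < n) {v : NoiseSpace H₀}
    (hv : ∀ᵐ s : ℝ, s ∈ Set.Iic (t n) → v s = 0) :
    ∀ᵐ ω ∂P, W (Φ k ω) (ω + ι v) = W (Φ k ω) ω := by
  have h := (ae_ball_iff (hΦ.finite k).countable).2 fun a _ => hι.shift_apply_ae (hW a) v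
  filter_upwards [h] with ω hω
  rw [hω _ ⟨ω, rfl⟩, hΦ.inner_eq_zero hkn ω hv, add_zero]

/-- Girsanov's theorem for finitely valued adapted increments. -/
theorem lintegral_girsanov (hΦ : IsAdaptedIncrements P ι t Φ) (hι : IsCameronMartinInclusion P ι)
    (hW : ∀ g, IsMeasurableFunctional P ι g (W g)) (n : ℕ) {F : Ω → ℝ≥0∞} (hF : Measurable F) :
    ∫⁻ ω, ENNReal.ofReal (Real.exp
        (∑ k ∈ Finset.range n, (-W (Φ k ω) ω - ‖Φ k ω‖ ^ 2 / 2))) *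
      F (ω + ι (∑ k ∈ Finset.range n, Φ k ω)) ∂P = ∫⁻ ω, F ω ∂P := by
  classical
  have : SecondCountableTopology Ω := UniformSpace.secondCountable_of_separable Ω
  induction n with
  | zero => simp
  | succ n ih =>
    set Z : Ω → ℝ≥0∞ := fun ω => ENNReal.ofReal (Real.exp
        (∑ k ∈ Finset.range n, (-W (Φ k ω) ω - ‖Φ k ω‖ ^ 2 / 2))) with hZ
    set S : Ω → Ω := fun ω => ι (∑ k ∈ Finset.range n, Φ k ω) with hS
    have hSm : Measurable S := by
      simp only [hS, map_sum]
      exact Finset.measurable_fun_sum _ fun k _ =>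
        hΦ.measurable_apply k (g := fun a _ => ι a) fun a => measurable_const
    have hZm : Measurable Z := by
      refine (Real.measurable_exp.comp (Finset.measurable_fun_sum _ fun k _ => ?_)).ennreal_ofReal
      exact hΦ.measurable_apply k (g := fun a ω => -W a ω - ‖a‖ ^ 2 / 2) fun a =>
        ((hW a).1.neg.sub_const _)
    let R := (hΦ.finite n).toFinset
    let K : NoiseSpace H₀ → Ω → ℝ≥0∞ := fun v =>
      (Φ n ⁻¹' {v}).indicator fun ω => Z ω * F (ω + S ω + ι v)
    have hKm : ∀ v, Measurable (K v) := fun v =>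
      (hZm.mul (hF.comp ((measurable_id.add hSm).add_const _))).indicator
        (hΦ.measurableSet_preimage n {v})
    have hsum : ∀ G : NoiseSpace H₀ → Ω → ℝ≥0∞, ∀ ω,
        ∑ v ∈ R, (Φ n ⁻¹' {v}).indicator (G v) ω = G (Φ n ω) ω := by
      intro G ω
      rw [Finset.sum_eq_single (Φ n ω)]
      · simp
      · intro v _ hv
        simp [Set.indicator, hv.symm]
      · intro h
        exact absurd (by simp [R]) h
    -- Cameron–Martin for the shift by `-v`. As `v` vanishes up to `t n`, this shift changes neither
    -- `Φ k` for `k ≤ n` nor `W (Φ k)` for `k < n`; hence `Z`, `S` and the event `Φ n = v` are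
    -- unaffected, and the shift by `v` in `F` cancels.
    have hK : ∀ v ∈ R, ∫⁻ ω, ENNReal.ofReal (Real.exp (-W v ω - ‖v‖ ^ 2 / 2)) * K v ω ∂P =
        ∫⁻ ω, (Φ n ⁻¹' {v}).indicator (fun ω => Z ω * F (ω + S ω)) ω ∂P := by
      intro v hv
      obtain ⟨ω₀, hω₀⟩ : v ∈ Set.range (Φ n) := by simpa [R] using hv
      have hv0 : ∀ᵐ s : ℝ, s ∈ Set.Iic (t n) → (-v) s = 0 := by
        rw [← hω₀]
        exact hΦ.neg.past n ω₀
      have hcm := hι.lintegral_shift (hW v).neg (hKm v)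
      simp only [Pi.neg_apply, norm_neg] at hcm
      rw [← hcm]
      refine lintegral_congr_ae ?_
      have h1 := ae_all_iff.2 fun k => eventually_imp_distrib_left.2 fun hk : k ≤ n =>
        hΦ.apply_shift_ae hι hk hv0
      have h2 := ae_all_iff.2 fun k => eventually_imp_distrib_left.2 fun hk : k < n =>
        hΦ.functional_shift_ae hι hW hk hv0
      filter_upwards [h1, h2] with ω h1 h2
      have hZ' : Z (ω + ι (-v)) = Z ω := by
        simp only [hZ]
        congr 2
        refine Finset.sum_congr rfl fun k hk => ?_
        rw [h1 k (Finset.mem_range.1 hk).le, h2 k (Finset.mem_range.1 hk)]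
      have hS' : S (ω + ι (-v)) = S ω := by
        simp only [hS]
        congr 1
        exact Finset.sum_congr rfl fun k hk => h1 k (Finset.mem_range.1 hk).le
      simp only [K, Set.indicator, Set.mem_preimage, h1 n le_rfl, hZ', hS']
      congr 3
      rw [map_neg]
      abel
    calc ∫⁻ ω, ENNReal.ofReal (Real.exp
            (∑ k ∈ Finset.range (n + 1), (-W (Φ k ω) ω - ‖Φ k ω‖ ^ 2 / 2))) *
          F (ω + ι (∑ k ∈ Finset.range (n + 1), Φ k ω)) ∂P
        = ∫⁻ ω, ∑ v ∈ R, ENNReal.ofReal (Real.exp (-W v ω - ‖v‖ ^ 2 / 2)) * K v ω ∂P := by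
          refine lintegral_congr fun ω => ?_
          have := hsum (fun v ω => ENNReal.ofReal (Real.exp (-W v ω - ‖v‖ ^ 2 / 2)) *
            (Z ω * F (ω + S ω + ι v))) ω
          have hK' : ∀ v, ENNReal.ofReal (Real.exp (-W v ω - ‖v‖ ^ 2 / 2)) * K v ω =
              (Φ n ⁻¹' {v}).indicator (fun ω => ENNReal.ofReal (Real.exp (-W v ω - ‖v‖ ^ 2 / 2)) *
                (Z ω * F (ω + S ω + ι v))) ω := by
            intro v
            simp only [K, Set.indicator]
            split_ifs <;> simp
          simp_rw [hK']
          rw [this, Finset.sum_range_succ, Finset.sum_range_succ, Real.exp_add,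
            ENNReal.ofReal_mul (Real.exp_pos _).le, map_add, ← add_assoc]
          ring
      _ = ∑ v ∈ R, ∫⁻ ω, (Φ n ⁻¹' {v}).indicator (fun ω => Z ω * F (ω + S ω)) ω ∂P := by
          rw [lintegral_finsetSum]
          · exact Finset.sum_congr rfl hK
          · intro v _
            exact ((Real.measurable_exp.comp ((hW v).1.neg.sub_const _)).ennreal_ofReal).mul (hKm v)
      _ = ∫⁻ ω, Z ω * F (ω + S ω) ∂P := by
          rw [← lintegral_finsetSum]
          · exact lintegral_congr fun ω => hsum (fun _ ω => Z ω * F (ω + S ω)) ω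
          · intro v _
            exact (hZm.mul (hF.comp (measurable_id.add hSm))).indicator
              (hΦ.measurableSet_preimage n {v})
      _ = ∫⁻ ω, F ω ∂P := ih

/-- The law of a shift by adapted increments of bounded square norm is absolutely continuous,
uniformly in terms of the bound. -/
theorem measure_shift_le_of_bounded (hΦ : IsAdaptedIncrements P ι t Φ)
    (hι : IsCameronMartinInclusion P ι) (n : ℕ) {N : ℝ}
    (hN : ∀ ω, ∑ k ∈ Finset.range n, ‖Φ k ω‖ ^ 2 ≤ N) {A : Set Ω} (hA : MeasurableSet A) :
    P {ω | ω + ι (∑ k ∈ Finset.range n, Φ k ω) ∈ A} ≤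
      ENNReal.ofReal (Real.exp (N / 2)) * P A ^ (1 / 2 : ℝ) := by
  have := hι.isGaussian
  have : SecondCountableTopology Ω := UniformSpace.secondCountable_of_separable Ω
  choose W hW using hι.exists_isMeasurableFunctional
  set T : Ω → Ω := fun ω => ω + ι (∑ k ∈ Finset.range n, Φ k ω) with hT
  have hTm : Measurable T := by
    simp only [hT, map_sum]
    exact measurable_id.add (Finset.measurable_fun_sum _ fun k _ =>
      hΦ.measurable_apply k (g := fun a _ => ι a) fun a => measurable_const)
  set X : Ω → ℝ := fun ω => ∑ k ∈ Finset.range n, (-W (Φ k ω) ω - ‖Φ k ω‖ ^ 2 / 2) with hX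
  have hXm : Measurable X := Finset.measurable_fun_sum _ fun k _ =>
    hΦ.measurable_apply k (g := fun a ω => -W a ω - ‖a‖ ^ 2 / 2) fun a =>
      ((hW a).1.neg.sub_const _)
  have h1 := hΦ.lintegral_girsanov hι hW n (measurable_one.indicator hA : Measurable
    (A.indicator (1 : Ω → ℝ≥0∞)))
  rw [lintegral_indicator_one hA] at h1
  -- Girsanov for the opposite increments with `F = 1`: the exponential with `+W` also has mean one.
  have h2 := hΦ.neg.lintegral_girsanov hι (W := fun g => -W (-g))
    (fun g => by simpa using (hW (-g)).neg) n (measurable_one : Measurable (1 : Ω → ℝ≥0∞))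
  simp only [Pi.neg_apply, neg_neg, norm_neg, Pi.one_apply, mul_one, lintegral_const,
    measure_univ] at h2
  -- Cauchy–Schwarz for the factorization of the indicator of `T ω ∈ A` into `a * b`: `a ^ 2`
  -- integrates to `P A` by `h1`, and `b ^ 2` is at most exp(N) times the mean-one density of `h2`.
  let a : Ω → ℝ≥0∞ := fun ω => ENNReal.ofReal (Real.exp (X ω / 2)) * A.indicator 1 (T ω)
  let b : Ω → ℝ≥0∞ := fun ω => ENNReal.ofReal (Real.exp (-X ω / 2))
  have ham : Measurable a :=
    (Real.measurable_exp.comp (hXm.div_const 2)).ennreal_ofReal.mul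
      ((measurable_one.indicator hA).comp hTm)
  have hbm : Measurable b := (Real.measurable_exp.comp (hXm.neg.div_const 2)).ennreal_ofReal
  have hexp : ∀ x : ℝ, ENNReal.ofReal (Real.exp (x / 2)) ^ (2 : ℝ) =
      ENNReal.ofReal (Real.exp x) := by
    intro x
    rw [ENNReal.ofReal_rpow_of_pos (Real.exp_pos _), ← Real.exp_mul]
    congr 2; ring
  have ha2 : ∫⁻ ω, a ω ^ (2 : ℝ) ∂P = P A := by
    rw [← h1]
    refine lintegral_congr fun ω => ?_
    simp only [a, ENNReal.mul_rpow_of_nonneg _ _ zero_le_two, hexp]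
    congr 1
    by_cases h : T ω ∈ A <;> simp [hT] at h <;> simp [hT, h]
  have hb2 : ∫⁻ ω, b ω ^ (2 : ℝ) ∂P ≤ ENNReal.ofReal (Real.exp N) := by
    calc ∫⁻ ω, b ω ^ (2 : ℝ) ∂P
        ≤ ∫⁻ ω, ENNReal.ofReal (Real.exp N) * ENNReal.ofReal (Real.exp
            (∑ k ∈ Finset.range n, (W (Φ k ω) ω - ‖Φ k ω‖ ^ 2 / 2))) ∂P := by
          refine lintegral_mono fun ω => ?_
          simp only [b, hexp]
          rw [← ENNReal.ofReal_mul (Real.exp_pos _).le, ← Real.exp_add]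
          refine ENNReal.ofReal_le_ofReal (Real.exp_le_exp.2 ?_)
          have := hN ω
          simp only [hX, Finset.sum_sub_distrib, Finset.sum_neg_distrib, ← Finset.sum_div]
          linarith
      _ = ENNReal.ofReal (Real.exp N) := by
          rw [lintegral_const_mul' _ _ ENNReal.ofReal_ne_top, h2, mul_one]
  have hab : ∫⁻ ω, (a * b) ω ∂P = P {ω | T ω ∈ A} := by
    rw [show {ω | T ω ∈ A} = T ⁻¹' A from rfl, ← lintegral_indicator_one (hTm hA)]
    refine lintegral_congr fun ω => ?_
    simp only [Pi.mul_apply, a, b]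
    rw [mul_right_comm, ← ENNReal.ofReal_mul (Real.exp_pos _).le, ← Real.exp_add]
    have : X ω / 2 + -X ω / 2 = 0 := by ring
    rw [this]
    simp [Set.indicator]
    rfl
  have hholder := ENNReal.lintegral_mul_le_Lp_mul_Lq P Real.HolderConjugate.two_two
    ham.aemeasurable hbm.aemeasurable
  rw [hab, ha2] at hholder
  refine hholder.trans ?_
  rw [mul_comm]
  refine mul_le_mul_left ((ENNReal.rpow_le_rpow hb2 (by norm_num)).trans_eq ?_) _
  rw [ENNReal.ofReal_rpow_of_pos (Real.exp_pos _), ← Real.exp_mul]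
  congr 2; ring

/-- By orthogonality the squared norm of the shift is the sum that the truncation monitors, so
truncation changes nothing off the last event. -/
theorem measure_shift_le (hΦ : IsAdaptedIncrements P ι t Φ)
    (hι : IsCameronMartinInclusion P ι) (n : ℕ) {N : ℝ} (hN : 0 ≤ N)
    {A : Set Ω} (hA : MeasurableSet A) :
    P {ω | ω + ι (∑ k ∈ Finset.range n, Φ k ω) ∈ A} ≤
      ENNReal.ofReal (Real.exp (N / 2)) * P A ^ (1 / 2 : ℝ) +
        P {ω | N < ‖∑ k ∈ Finset.range n, Φ k ω‖ ^ 2} := by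
  refine le_trans ?_ (add_le_add_left ((hΦ.truncated N).measure_shift_le_of_bounded hι n
    (fun ω => sum_norm_truncate_le Φ hN n ω) hA) _)
  refine le_trans (measure_mono fun ω hω => ?_) (measure_union_le _ _)
  by_cases h : N < ‖∑ k ∈ Finset.range n, Φ k ω‖ ^ 2
  · exact Or.inr h
  · left
    rw [hΦ.norm_sum_sq, not_lt] at h
    change _ ∈ A
    rw [sum_truncate_eq Φ h]
    exact hω

end IsAdaptedIncrements

end Girsanov

/-! ### Density of step processes among predictable processes -/

section StepProcess

open scoped symmDiff

variable {Ω T E : Type*} {m : MeasurableSpace Ω} [LinearOrder T] [OrderBot T]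
  {𝓕 : Filtration T m} {D D' : Finset T}

/-- Predictable sets that are, in time, constant between the times of `D`. -/
structure IsStepSet (𝓕 : Filtration T m) (D : Finset T) (A : Set (T × Ω)) : Prop where
  measurable : MeasurableSet[𝓕.predictable] A
  cell : ∀ s s', (∀ d ∈ D, d < s ↔ d < s') → ∀ ω, (s, ω) ∈ A ↔ (s', ω) ∈ A
  -- Cells are open on the left and closed on the right. The hypothesis says that no time of `D`
  -- lies strictly between `r` and `s`; the section at `s` is then already known at `r`, in
  -- particular at the left end of the cell.
  adapted : ∀ r s, r ≤ s → (∀ d ∈ D, d < s → d ≤ r) → MeasurableSet[𝓕 r] {ω | (s, ω) ∈ A}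

theorem IsStepSet.mono {A : Set (T × Ω)} (hA : IsStepSet 𝓕 D A) (hD : D ⊆ D') :
    IsStepSet 𝓕 D' A where
  measurable := hA.measurable
  cell s s' h := hA.cell s s' fun d hd => h d (hD hd)
  adapted r s hrs h := hA.adapted r s hrs fun d hd => h d (hD hd)

theorem isSetAlgebra_isStepSet (𝓕 : Filtration T m) :
    IsSetAlgebra {A | ∃ D, IsStepSet 𝓕 D A} where
  empty_mem := ⟨∅, @MeasurableSet.empty _ 𝓕.predictable, by simp, by simp⟩
  compl_mem := by
    rintro A ⟨D, hA⟩
    exact ⟨D, hA.measurable.compl, fun s s' h ω => not_congr (hA.cell s s' h ω),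
      fun r s hrs h => (hA.adapted r s hrs h).compl⟩
  union_mem := by
    classical
    rintro A B ⟨D, hA⟩ ⟨D', hB⟩
    have hA := hA.mono (D' := D ∪ D') Finset.subset_union_left
    have hB := hB.mono (D' := D ∪ D') Finset.subset_union_right
    exact ⟨D ∪ D', hA.measurable.union hB.measurable,
      fun s s' h ω => or_congr (hA.cell s s' h ω) (hB.cell s s' h ω),
      fun r s hrs h => (hA.adapted r s hrs h).union (hB.adapted r s hrs h)⟩

theorem predictable_eq_generateFrom_isStepSet (𝓕 : Filtration T m) :
    𝓕.predictable = MeasurableSpace.generateFrom {A | ∃ D, IsStepSet 𝓕 D A} := by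
  refine le_antisymm ?_ (MeasurableSpace.generateFrom_le fun A ⟨D, hA⟩ => hA.measurable)
  refine measurableSpace_le_predictable_of_measurableSet ?_ ?_
  · intro A hA
    refine MeasurableSpace.measurableSet_generateFrom
      ⟨{⊥}, measurableSet_predictable_singleton_bot_prod hA, ?_, ?_⟩
    · intro s s' h ω
      simp only [Finset.mem_singleton, forall_eq, bot_lt_iff_ne_bot] at h
      simp [not_iff_not.1 h]
    · intro r s hrs _
      by_cases hs : s = ⊥
      · subst hs
        obtain rfl := le_bot_iff.1 hrs
        simpa using hA
      · simp [hs]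
  · intro i A hA
    refine MeasurableSpace.measurableSet_generateFrom
      ⟨{i}, measurableSet_predictable_Ioi_prod hA, ?_, ?_⟩
    · intro s s' h ω
      simp only [Finset.mem_singleton, forall_eq] at h
      simp [h]
    · intro r s hrs h
      simp only [Finset.mem_singleton, forall_eq] at h
      by_cases hs : i < s
      · simpa [hs] using 𝓕.mono (h hs) _ hA
      · simp [hs]

variable [NormedAddCommGroup E]

/-- Finitely valued predictable processes that are constant between the times of `D`. -/
structure IsStepProcess (𝓕 : Filtration T m) (D : Finset T) (u : T → Ω → E) : Prop where
  measurable : StronglyMeasurable[𝓕.predictable] (Function.uncurry u)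
  finite : (Set.range (Function.uncurry u)).Finite
  cell : ∀ s s', (∀ d ∈ D, d < s ↔ d < s') → u s = u s'
  adapted : ∀ r s, r ≤ s → (∀ d ∈ D, d < s → d ≤ r) → ∀ B, MeasurableSet[𝓕 r] (u s ⁻¹' B)

theorem IsStepProcess.mono {u : T → Ω → E} (hu : IsStepProcess 𝓕 D u) (hD : D ⊆ D') :
    IsStepProcess 𝓕 D' u where
  measurable := hu.measurable
  finite := hu.finite
  cell s s' h := hu.cell s s' fun d hd => h d (hD hd)
  adapted r s hrs h := hu.adapted r s hrs fun d hd => h d (hD hd)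

theorem IsStepProcess.finite_range {u : T → Ω → E} (hu : IsStepProcess 𝓕 D u) (s : T) :
    (Set.range (u s)).Finite :=
  hu.finite.subset (by rintro _ ⟨ω, rfl⟩; exact ⟨(s, ω), rfl⟩)

theorem IsStepProcess.add {u v : T → Ω → E} (hu : IsStepProcess 𝓕 D u)
    (hv : IsStepProcess 𝓕 D v) : IsStepProcess 𝓕 D (u + v) where
  measurable := hu.measurable.add hv.measurable
  finite := by
    refine (hu.finite.add hv.finite).subset ?_
    rintro _ ⟨x, rfl⟩
    exact Set.add_mem_add ⟨x, rfl⟩ ⟨x, rfl⟩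
  cell s s' h := by simp [hu.cell s s' h, hv.cell s s' h]
  adapted r s hrs h B := by
    have : (u + v) s ⁻¹' B = ⋃ a ∈ Set.range (u s), u s ⁻¹' {a} ∩ v s ⁻¹' {b | a + b ∈ B} := by
      ext ω
      simp only [Set.mem_preimage, Pi.add_apply, Set.mem_iUnion, Set.mem_inter_iff,
        Set.mem_singleton_iff, exists_prop, Set.mem_ofPred_eq]
      exact ⟨fun h => ⟨u s ω, ⟨ω, rfl⟩, rfl, h⟩, fun ⟨a, _, h1, h2⟩ => h1 ▸ h2⟩
    rw [this]
    exact (hu.finite_range s).measurableSet_biUnion fun a _ =>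
      (hu.adapted r s hrs h _).inter (hv.adapted r s hrs h _)

theorem IsStepSet.isStepProcess {A : Set (T × Ω)} (hA : IsStepSet 𝓕 D A) (c : E) :
    IsStepProcess 𝓕 D (Function.curry (A.indicator fun _ => c)) where
  measurable := by
    rw [Function.uncurry_curry]
    exact stronglyMeasurable_const.indicator hA.measurable
  finite := by
    classical
    rw [Function.uncurry_curry]
    refine (Set.toFinite {c, 0}).subset ?_
    rintro _ ⟨x, rfl⟩
    by_cases hx : x ∈ A <;> simp [hx]
  cell s s' h := by
    ext ω
    have := hA.cell s s' h ω
    by_cases hs : (s, ω) ∈ A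
    · simp [hs, this.1 hs]
    · simp [hs, mt this.2 hs]
  adapted r s hrs h B := by
    have : Function.curry (A.indicator fun _ => c) s =
        {ω | (s, ω) ∈ A}.indicator fun _ => c := rfl
    rw [this]
    classical
    rw [Set.indicator_const_preimage_eq_union]
    refine @MeasurableSet.union _ (𝓕 r) _ _ ?_ ?_
    · split_ifs
      · exact hA.adapted r s hrs h
      · exact @MeasurableSet.empty _ (𝓕 r)
    · split_ifs
      · exact (hA.adapted r s hrs h).compl
      · exact @MeasurableSet.empty _ (𝓕 r)

variable [MeasurableSpace T] [TopologicalSpace T] [OrderClosedTopology T] [OpensMeasurableSpace T]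

theorem predictable_le_prod (𝓕 : Filtration T m) :
    𝓕.predictable ≤ (inferInstance : MeasurableSpace (T × Ω)) := by
  refine measurableSpace_le_predictable_of_measurableSet ?_ ?_
  · intro A hA
    exact (measurableSet_singleton _).prod (𝓕.le _ _ hA)
  · intro i A hA
    exact measurableSet_Ioi.prod (𝓕.le _ _ hA)

/-- By density of simple functions only indicators matter, and exchanging a set for a nearby one
costs the norm of `c` on a small symmetric difference. -/
theorem MeasureTheory.MemLp.exists_eLpNorm_sub_le_of_measureDense {X : Type*}
    {mX : MeasurableSpace X} {μ : Measure X} [IsFiniteMeasure μ] {q : ℝ≥0∞} {u : X → E}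
    (hu : MemLp u q μ) (hq : q ≠ ∞) {𝒜 : Set (Set X)} (h𝒜 : μ.MeasureDense 𝒜)
    (Q : (X → E) → Prop) (hind : ∀ c, ∀ A ∈ 𝒜, Q (A.indicator fun _ => c))
    (hadd : ∀ f g, Q f → Q g → Q (f + g)) (hmeas : ∀ f, Q f → AEStronglyMeasurable f μ)
    {ε : ℝ≥0∞} (hε : ε ≠ 0) : ∃ g, eLpNorm (u - g) q μ ≤ ε ∧ Q g := by
  refine MemLp.induction_dense hq Q ?_ hadd hmeas hu hε
  intro c s hs _ ε hε
  obtain ⟨η, hη, h⟩ := exists_eLpNorm_indicator_le (μ := μ) hq c hε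
  obtain ⟨A, hA, hsA⟩ := h𝒜.approx s hs (measure_ne_top _ _) η hη
  refine ⟨A.indicator fun _ => c, ?_, hind c A hA⟩
  rw [eLpNorm_indicator_sub_indicator]
  refine h _ ?_
  rw [symmDiff_comm]
  exact hsA.le.trans (by simp)

/-- Step processes are dense among the predictable processes. -/
theorem exists_isStepProcess_eLpNorm_sub_le {q : ℝ≥0∞} (hq : q ≠ ∞) (μ : Measure (T × Ω))
    [IsFiniteMeasure μ] {u : T × Ω → E} (hu : StronglyMeasurable[𝓕.predictable] u)
    (hmem : MemLp u q μ) {ε : ℝ≥0∞} (hε : ε ≠ 0) :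
    ∃ D v, IsStepProcess 𝓕 D v ∧ eLpNorm (u - Function.uncurry v) q μ ≤ ε := by
  classical
  have hle := predictable_le_prod 𝓕
  -- Working with the measure trimmed to the predictable σ-algebra keeps the approximating sets
  -- predictable; the step sets form an algebra generating it.
  have hdense := @Measure.MeasureDense.of_generateFrom_isSetAlgebra_finite _ 𝓕.predictable
    (μ.trim hle) _ _ (isSetAlgebra_isStepSet 𝓕) (predictable_eq_generateFrom_isStepSet 𝓕)
  have hmem' : @MemLp _ _ 𝓕.predictable _ _ u q (μ.trim hle) :=
    ⟨hu.aestronglyMeasurable, by rw [eLpNorm_trim hle hu]; exact hmem.2⟩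
  obtain ⟨g, hg, D, hD⟩ := hmem'.exists_eLpNorm_sub_le_of_measureDense hq hdense
    (fun g => ∃ D, IsStepProcess 𝓕 D (Function.curry g))
    (fun c A ⟨D, hA⟩ => ⟨D, hA.isStepProcess c⟩)
    (fun f g ⟨D, hf⟩ ⟨D', hg⟩ =>
      ⟨D ∪ D', (hf.mono Finset.subset_union_left).add (hg.mono Finset.subset_union_right)⟩)
    (fun f ⟨D, hf⟩ => by
      have := hf.measurable
      rw [Function.uncurry_curry] at this
      exact this.aestronglyMeasurable) hε
  refine ⟨D, _, hD, ?_⟩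
  have hgm := hD.measurable
  rw [Function.uncurry_curry] at hgm ⊢
  rwa [eLpNorm_trim hle (hu.sub hgm)] at hg

end StepProcess

/-! ### Almost sure approximation of paths -/

section PathwiseApproximation

theorem tendsto_eLpNorm_zero_iff_lintegral {α E : Type*} [MeasurableSpace α] {μ : Measure α}
    [NormedAddCommGroup E] {q : ℝ≥0∞} (hq0 : q ≠ 0) (hq : q ≠ ∞) {f : ℕ → α → E} :
    Tendsto (fun n => eLpNorm (f n) q μ) atTop (𝓝 0) ↔
      Tendsto (fun n => ∫⁻ x, ‖f n x‖ₑ ^ q.toReal ∂μ) atTop (𝓝 0) := by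
  have hpos := ENNReal.toReal_pos hq0 hq
  simp_rw [eLpNorm_eq_lintegral_rpow_enorm_toReal hq0 hq]
  constructor
  · intro h
    have := (ENNReal.continuous_rpow_const (y := q.toReal)).tendsto 0 |>.comp h
    simpa [Function.comp_def, ← ENNReal.rpow_mul, hpos.ne', ENNReal.zero_rpow_of_pos hpos] using this
  · intro h
    have := (ENNReal.continuous_rpow_const (y := 1 / q.toReal)).tendsto 0 |>.comp h
    simpa [Function.comp_def, ENNReal.zero_rpow_of_pos (inv_pos.2 hpos)] using this

theorem MeasureTheory.MemLp.tendsto_eLpNorm_sub_indicator_norm_le {α E : Type*}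
    [MeasurableSpace α] {μ : Measure α} [NormedAddCommGroup E] {q : ℝ≥0∞} (hq0 : q ≠ 0)
    (hq : q ≠ ∞) {f : α → E} (hf : MemLp f q μ) :
    Tendsto (fun n : ℕ => eLpNorm (fun x => f x - {x | ‖f x‖ ≤ n}.indicator f x) q μ)
      atTop (𝓝 0) := by
  have hpos := ENNReal.toReal_pos hq0 hq
  rw [tendsto_eLpNorm_zero_iff_lintegral hq0 hq]
  have hfin := lintegral_rpow_enorm_lt_top_of_eLpNorm_lt_top hq0 hq hf.2
  have hset : ∀ n : ℕ, NullMeasurableSet {x | ‖f x‖ ≤ n} μ := fun n =>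
    nullMeasurableSet_le hf.1.norm.aemeasurable aemeasurable_const
  have h := tendsto_lintegral_of_dominated_convergence' (μ := μ)
    (F := fun (n : ℕ) x => ‖f x - {x | ‖f x‖ ≤ n}.indicator f x‖ₑ ^ q.toReal)
    (f := fun _ => 0) (fun x => ‖f x‖ₑ ^ q.toReal)
    (fun n => ((hf.1.sub (hf.1.indicator₀ (hset n))).enorm.pow_const _))
    (fun n => .of_forall fun x => ?_) hfin.ne (.of_forall fun x => ?_)
  · simpa using h
  · refine ENNReal.rpow_le_rpow ?_ hpos.le
    by_cases hx : ‖f x‖ ≤ n <;> simp [Set.indicator, hx]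
  · obtain ⟨N, hN⟩ := exists_nat_ge ‖f x‖
    refine tendsto_const_nhds.congr' ?_
    filter_upwards [eventually_ge_atTop N] with n hn
    have : ‖f x‖ ≤ n := hN.trans (by exact_mod_cast hn)
    simp [Set.indicator, this, ENNReal.zero_rpow_of_pos hpos]

variable {Ω T E : Type*} {m : MeasurableSpace Ω} [LinearOrder T] [OrderBot T]
  {𝓕 : Filtration T m} [NormedAddCommGroup E]
  [MeasurableSpace T] [TopologicalSpace T] [OrderClosedTopology T] [OpensMeasurableSpace T]

/-- A predictable process with paths in `L^q` is almost surely the pathwise `L^q` limit of step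
processes. -/
theorem exists_isStepProcess_tendsto_eLpNorm {q : ℝ≥0∞} (hq1 : 1 ≤ q) (hq : q ≠ ∞)
    (ν : Measure T) [IsFiniteMeasure ν] (P : Measure Ω) [IsFiniteMeasure P] {u : T → Ω → E}
    (hu : IsStronglyPredictable 𝓕 u) (hmem : ∀ᵐ ω ∂P, MemLp (fun s => u s ω) q ν) :
    ∃ (D : ℕ → Finset T) (v : ℕ → T → Ω → E), (∀ n, IsStepProcess 𝓕 (D n) (v n)) ∧
      ∀ᵐ ω ∂P, Tendsto (fun n => eLpNorm (fun s => u s ω - v n s ω) q ν) atTop (𝓝 0) := by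
  have hq0 : q ≠ 0 := (zero_lt_one.trans_le hq1).ne'
  have hpos := ENNReal.toReal_pos hq0 hq
  have hle := predictable_le_prod 𝓕
  -- Only the paths of `u` are in L^q, not `u` itself on the product, so `u` is first cut off at
  -- height `n`.
  let w : ℕ → T × Ω → E := fun n =>
    {x | ‖Function.uncurry u x‖ ≤ n}.indicator (Function.uncurry u)
  have hu' : StronglyMeasurable[𝓕.predictable] (Function.uncurry u) := hu
  have hw : ∀ n, StronglyMeasurable[𝓕.predictable] (w n) := fun n =>
    hu'.indicator (hu'.norm.measurable measurableSet_Iic)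
  have hwmem : ∀ n, MemLp (w n) q (ν.prod P) := fun n => by
    refine MemLp.of_bound ((hw n).mono hle).aestronglyMeasurable n (.of_forall fun x => ?_)
    by_cases hx : ‖Function.uncurry u x‖ ≤ n
    · simp [w, hx]
    · simp [w, hx]
  choose D v hv hvε using fun n => exists_isStepProcess_eLpNorm_sub_le hq (ν.prod P) (hw n)
    (hwmem n) (ε := ((2 : ℝ≥0∞)⁻¹ ^ n) ^ (1 / q.toReal)) (by simp)
  refine ⟨D, v, hv, ?_⟩
  let d : ℕ → T × Ω → E := fun n => w n - Function.uncurry (v n)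
  have hdm : ∀ n, StronglyMeasurable (d n) := fun n =>
    ((hw n).mono hle).sub ((hv n).measurable.mono hle)
  have hd : ∀ n, ∫⁻ ω, ∫⁻ s, ‖d n (s, ω)‖ₑ ^ q.toReal ∂ν ∂P ≤ 2⁻¹ ^ n := by
    intro n
    have h := hvε n
    rw [eLpNorm_eq_lintegral_rpow_enorm_toReal hq0 hq,
      ENNReal.rpow_le_rpow_iff (by positivity)] at h
    rwa [lintegral_prod_symm' _ ((hdm n).enorm.pow_const _)] at h
  have hinner : ∀ n, Measurable fun ω => ∫⁻ s, ‖d n (s, ω)‖ₑ ^ q.toReal ∂ν := fun n =>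
    Measurable.lintegral_prod_left' ((hdm n).enorm.pow_const _)
  -- The accuracy was chosen so that the q-th powers of the errors have summable expectations; hence
  -- almost surely they are summable and tend to zero, without passing to a subsequence.
  have hsum : ∫⁻ ω, ∑' n, ∫⁻ s, ‖d n (s, ω)‖ₑ ^ q.toReal ∂ν ∂P ≠ ∞ := by
    rw [lintegral_tsum fun n => (hinner n).aemeasurable]
    refine ne_top_of_le_ne_top ?_ (ENNReal.tsum_le_tsum hd)
    rw [ENNReal.tsum_geometric]
    simp
  have hae := ae_lt_top (Measurable.tsum hinner) hsum
  filter_upwards [hae, hmem] with ω h1 h2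
  have h3 : Tendsto (fun n => eLpNorm (fun s => d n (s, ω)) q ν) atTop (𝓝 0) :=
    (tendsto_eLpNorm_zero_iff_lintegral hq0 hq).2
      (ENNReal.tendsto_atTop_zero_of_tsum_ne_top h1.ne)
  have h4 := h2.tendsto_eLpNorm_sub_indicator_norm_le hq0 hq
  have h5 := h4.add h3
  rw [add_zero] at h5
  refine tendsto_of_tendsto_of_tendsto_of_le_of_le tendsto_const_nhds h5
    (fun _ => zero_le) fun n => ?_
  have hwn : AEStronglyMeasurable (fun s => w n (s, ω)) ν :=
    (((hw n).mono hle).comp_measurable measurable_prodMk_right).aestronglyMeasurable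
  have hdn : AEStronglyMeasurable (fun s => d n (s, ω)) ν :=
    ((hdm n).comp_measurable measurable_prodMk_right).aestronglyMeasurable
  refine le_trans (le_of_eq ?_) (eLpNorm_add_le (h2.1.sub hwn) hdn hq1)
  congr 1
  ext s
  change u s ω - v n s ω = (u s ω - w n (s, ω)) + (w n (s, ω) - v n s ω)
  abel

end PathwiseApproximation

/-! ### Partitions of the unit interval -/

section StepShift

theorem exists_monotone_enumeration (D : Finset unitInterval) :
    ∃ (t : ℕ → unitInterval) (n : ℕ), Monotone t ∧ t 0 = 0 ∧ t n = 1 ∧ ∀ d ∈ D, ∃ k, t k = d := by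
  let D' : Finset unitInterval := insert 0 (insert 1 D)
  have hne : D'.card ≠ 0 := by simp [D']
  have hpos : 0 < D'.card := Nat.pos_of_ne_zero hne
  -- Capping the index makes `t` constant after the last point, so later cells are empty.
  let t : ℕ → unitInterval := fun k =>
    D'.orderEmbOfFin rfl ⟨min k (D'.card - 1), by omega⟩
  have hmono : Monotone t := fun i k hik =>
    (D'.orderEmbOfFin rfl).monotone (Fin.mk_le_mk.2 (by omega))
  have hsurj : ∀ d ∈ D', ∃ k, k ≤ D'.card - 1 ∧ t k = d := by
    intro d hd
    have : d ∈ Set.range (D'.orderEmbOfFin rfl) := by simpa using hd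
    obtain ⟨k, hk⟩ := this
    refine ⟨k, by omega, ?_⟩
    rw [← hk]
    exact congrArg _ (Fin.ext (by simp; omega))
  obtain ⟨k0, -, hk0⟩ := hsurj 0 (by simp [D'])
  obtain ⟨k1, hk1', hk1⟩ := hsurj 1 (by simp [D'])
  refine ⟨t, D'.card - 1, hmono, ?_, ?_, fun d hd => ?_⟩
  · exact le_antisymm (hk0 ▸ hmono (Nat.zero_le _)) unitInterval.nonneg'
  · exact le_antisymm unitInterval.le_one' (hk1 ▸ hmono hk1')
  · obtain ⟨k, -, hk⟩ := hsurj d (by simp [D', hd])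
    exact ⟨k, hk⟩

theorem sum_indicator_Ioc_eq {E : Type*} [AddCommMonoid E] {t : ℕ → unitInterval}
    (ht : Monotone t) {f : unitInterval → E}
    (hf : ∀ k s, s ∈ Set.Ioc (t k) (t (k + 1)) → f s = f (t (k + 1))) (n : ℕ) (s : unitInterval) :
    ∑ k ∈ Finset.range n, (Set.Ioc (t k) (t (k + 1))).indicator (fun _ => f (t (k + 1))) s =
      (Set.Ioc (t 0) (t n)).indicator f s := by
  induction n with
  | zero => simp
  | succ n ih =>
    rw [Finset.sum_range_succ, ih, ← Set.Ioc_union_Ioc_eq_Ioc (ht (Nat.zero_le n))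
      (ht (Nat.le_succ n)), Set.indicator_union_of_disjoint (Set.Ioc_disjoint_Ioc_of_le le_rfl)]
    congr 1
    by_cases hs : s ∈ Set.Ioc (t n) (t (n + 1))
    · simp [hs, hf n s hs]
    · simp [hs]

end StepShift

/-! ### The inclusion of shifts into the noise space -/

section ShiftInclusion

variable {X₀ H₀ : Type*} [NormedAddCommGroup X₀] [NormedSpace ℝ X₀]
  [NormedAddCommGroup H₀] [NormedSpace ℝ H₀] {p : ℝ≥0∞}

theorem coeFn_shiftInclusion (j : X₀ →L[ℝ] H₀) (hp : 2 ≤ p) (h : ShiftSpace X₀ p) :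
    shiftInclusion j hp h =ᵐ[volume] (Set.Icc (0 : ℝ) 1).indicator fun s => j (h s) :=
  MemLp.coeFn_toLp _

theorem shiftInclusion_add (j : X₀ →L[ℝ] H₀) (hp : 2 ≤ p) (h h' : ShiftSpace X₀ p) :
    shiftInclusion j hp (h + h') = shiftInclusion j hp h + shiftInclusion j hp h' := by
  refine Lp.ext ?_
  filter_upwards [coeFn_shiftInclusion j hp (h + h'), coeFn_shiftInclusion j hp h,
    coeFn_shiftInclusion j hp h', Lp.coeFn_add (shiftInclusion j hp h) (shiftInclusion j hp h'),
    (ae_restrict_iff' measurableSet_Icc).1 (Lp.coeFn_add h h')] with s h1 h2 h3 h4 h5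
  rw [h4, Pi.add_apply, h1, h2, h3]
  by_cases hs : s ∈ Set.Icc (0 : ℝ) 1
  · simp only [Set.indicator_of_mem hs]
    rw [h5 hs, Pi.add_apply, map_add]
  · simp only [Set.indicator_of_notMem hs, add_zero]

theorem norm_shiftInclusion_le (j : X₀ →L[ℝ] H₀) (hp : 2 ≤ p) (h : ShiftSpace X₀ p) :
    ‖shiftInclusion j hp h‖ ≤ ‖j‖ * ‖h‖ := by
  have : IsProbabilityMeasure (volume.restrict (Set.Icc (0 : ℝ) 1)) := ⟨by simp⟩
  rw [shiftInclusion, Lp.norm_toLp, Lp.norm_def,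
    eLpNorm_indicator_eq_eLpNorm_restrict measurableSet_Icc, ← ENNReal.toReal_ofReal (norm_nonneg j),
    ← ENNReal.toReal_mul]
  refine ENNReal.toReal_mono (ENNReal.mul_ne_top ENNReal.ofReal_ne_top (Lp.eLpNorm_ne_top h)) ?_
  refine (eLpNorm_le_mul_eLpNorm_of_ae_le_mul (g := h) (.of_forall fun s => j.le_opNorm (h s)) 2).trans
    ?_
  gcongr
  exact eLpNorm_le_eLpNorm_of_exponent_le hp (Lp.aestronglyMeasurable h)

/-- `shiftInclusion` as an additive homomorphism. -/
def shiftInclusionHom (j : X₀ →L[ℝ] H₀) (hp : 2 ≤ p) : ShiftSpace X₀ p →+ NoiseSpace H₀ :=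
  AddMonoidHom.mk' (shiftInclusion j hp) (shiftInclusion_add j hp)

theorem continuous_shiftInclusion [Fact (1 ≤ p)] (j : X₀ →L[ℝ] H₀) (hp : 2 ≤ p) :
    Continuous (shiftInclusion j hp : ShiftSpace X₀ p → NoiseSpace H₀) :=
  AddMonoidHomClass.continuous_of_bound (shiftInclusionHom j hp) ‖j‖
    (norm_shiftInclusion_le j hp)

theorem shiftInclusion_sum (j : X₀ →L[ℝ] H₀) (hp : 2 ≤ p) {α : Type*} (S : Finset α)
    (h : α → ShiftSpace X₀ p) :
    shiftInclusion j hp (∑ a ∈ S, h a) = ∑ a ∈ S, shiftInclusion j hp (h a) :=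
  map_sum (shiftInclusionHom j hp) h S

theorem shiftInclusion_indicatorConstLp (j : X₀ →L[ℝ] H₀) (hp : 2 ≤ p) {A : Set ℝ}
    (hA : MeasurableSet A) (hsub : A ⊆ Set.Icc 0 1)
    (hfin : volume.restrict (Set.Icc (0 : ℝ) 1) A ≠ ∞) (hfin' : volume A ≠ ∞) (c : X₀) :
    shiftInclusion j hp (indicatorConstLp p hA hfin c) = indicatorConstLp 2 hA hfin' (j c) := by
  refine Lp.ext ?_
  filter_upwards [coeFn_shiftInclusion j hp (indicatorConstLp p hA hfin c),
    indicatorConstLp_coeFn (p := 2) (hs := hA) (hμs := hfin') (c := j c),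
    (ae_restrict_iff' measurableSet_Icc).1
      (indicatorConstLp_coeFn (p := p) (hs := hA) (hμs := hfin) (c := c))] with s h1 h2 h3
  rw [h1, h2]
  by_cases hs : s ∈ Set.Icc (0 : ℝ) 1
  · rw [Set.indicator_of_mem hs, h3 hs]
    by_cases hsA : s ∈ A <;> simp [hsA]
  · rw [Set.indicator_of_notMem hs, Set.indicator_of_notMem fun h => hs (hsub h)]

end ShiftInclusion

/-! ### From step processes to adapted shifts -/

section StepShift

variable {Ω : Type*} [NormedAddCommGroup Ω] [NormedSpace ℝ Ω] [MeasurableSpace Ω]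
  {H₀ : Type*} [NormedAddCommGroup H₀] [InnerProductSpace ℝ H₀] [CompleteSpace H₀]
  {P : Measure Ω} {ι : NoiseSpace H₀ →L[ℝ] Ω}
  {X₀ : Type*} [NormedAddCommGroup X₀] [NormedSpace ℝ X₀] {p : ℝ≥0∞}

/-- A step process defines a finitely valued random shift, whose image in the noise space is a sum
of adapted increments. -/
theorem IsStepProcess.exists_shift {D : Finset unitInterval} {v : unitInterval → Ω → X₀}
    (hv : IsStepProcess (noiseFiltration P ι) D v) (j : X₀ →L[ℝ] H₀) (hp : 2 ≤ p) :
    ∃ (t : ℕ → ℝ) (n : ℕ) (Φ : ℕ → Ω → NoiseSpace H₀) (g : Ω → ShiftSpace X₀ p),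
      IsAdaptedIncrements P ι t Φ ∧ (Set.range g).Finite ∧
      (∀ ω, ∀ᵐ s : ℝ, ∀ hs : s ∈ Set.Icc (0 : ℝ) 1, g ω s = v ⟨s, hs⟩ ω) ∧
      ∀ ω, shiftInclusion j hp (g ω) = ∑ k ∈ Finset.range n, Φ k ω := by
  obtain ⟨t, n, hmono, h0, h1, hD⟩ := exists_monotone_enumeration D
  have hcell : ∀ k s, s ∈ Set.Ioc (t k) (t (k + 1)) → v s = v (t (k + 1)) := by
    intro k s hs
    refine hv.cell _ _ fun d hd => ⟨fun h => h.trans_le hs.2, fun h => ?_⟩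
    obtain ⟨i, rfl⟩ := hD d hd
    exact (hmono (Nat.lt_succ_iff.1 (hmono.reflect_lt h))).trans_lt hs.1
  let A : ℕ → Set ℝ := fun k => Set.Ioc (t k : ℝ) (t (k + 1))
  have hA : ∀ k, MeasurableSet (A k) := fun k => measurableSet_Ioc
  have hfin : ∀ k, volume (A k) ≠ ∞ := fun k => by simp [A]
  have hfin' : ∀ k, volume.restrict (Set.Icc (0 : ℝ) 1) (A k) ≠ ∞ := fun k => measure_ne_top _ _
  have hsub : ∀ k, A k ⊆ Set.Icc 0 1 := fun k s hs =>
    ⟨(t k).2.1.trans hs.1.le, hs.2.trans (t (k + 1)).2.2⟩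
  -- The value on a cell is read off at its right end, which belongs to the cell; adaptedness of the
  -- step process makes it measurable at the left end.
  let Φ : ℕ → Ω → NoiseSpace H₀ := fun k ω =>
    indicatorConstLp 2 (hA k) (hfin k) (j (v (t (k + 1)) ω))
  let g : Ω → ShiftSpace X₀ p := fun ω =>
    ∑ k ∈ Finset.range n, indicatorConstLp p (hA k) (hfin' k) (v (t (k + 1)) ω)
  refine ⟨fun k => t k, n, Φ, g, ⟨fun a b hab => hmono hab, fun k => ?_, fun k B => ?_, fun k ω => ?_,
    fun k ω => ?_⟩, ?_, fun ω => ?_, fun ω => ?_⟩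
  · refine ((hv.finite_range (t (k + 1))).image
      fun c => indicatorConstLp 2 (hA k) (hfin k) (j c)).subset ?_
    rintro _ ⟨ω, rfl⟩
    exact ⟨_, ⟨ω, rfl⟩, rfl⟩
  · refine hv.adapted (t k) (t (k + 1)) (hmono (Nat.le_succ k)) (fun d hd h => ?_)
      {c | indicatorConstLp 2 (hA k) (hfin k) (j c) ∈ B}
    obtain ⟨i, rfl⟩ := hD d hd
    exact hmono (Nat.lt_succ_iff.1 (hmono.reflect_lt h))
  · filter_upwards [indicatorConstLp_coeFn (p := 2) (hs := hA k) (hμs := hfin k)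
      (c := j (v (t (k + 1)) ω))] with s hs hst
    rw [hs, Set.indicator_of_notMem]
    exact fun h => h.1.not_ge hst
  · filter_upwards [indicatorConstLp_coeFn (p := 2) (hs := hA k) (hμs := hfin k)
      (c := j (v (t (k + 1)) ω))] with s hs hst
    rw [hs, Set.indicator_of_notMem]
    exact fun h => h.2.not_gt hst
  · refine ((Set.Finite.pi' fun k : Fin n => hv.finite_range (t (k + 1))).image
      fun c => ∑ k : Fin n, indicatorConstLp p (hA k) (hfin' k) (c k)).subset ?_
    rintro _ ⟨ω, rfl⟩
    refine ⟨fun k => v (t (k + 1)) ω, fun k => ⟨ω, rfl⟩, ?_⟩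
    exact Fin.sum_univ_eq_sum_range
      (fun k => indicatorConstLp p (hA k) (hfin' k) (v (t (k + 1)) ω)) n
  -- The half-open cells miss the time zero, which is a null set.
  · have hne : ∀ᵐ s : ℝ, s ≠ 0 := by simp [ae_iff]
    have hcoe := (ae_restrict_iff' measurableSet_Icc).1 (ae_all_iff.2 fun k =>
      indicatorConstLp_coeFn (p := p) (hs := hA k) (hμs := hfin' k) (c := v (t (k + 1)) ω))
    have hsum := (ae_restrict_iff' measurableSet_Icc).1 (Lp.coeFn_finsetSum (Finset.range n)
      fun k => indicatorConstLp p (hA k) (hfin' k) (v (t (k + 1)) ω))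
    filter_upwards [hne, hcoe, hsum] with s hs0 hs1 hs2 hs
    have h := sum_indicator_Ioc_eq hmono (f := fun s => v s ω)
      (fun k s hs => congrFun (hcell k s hs) ω) n ⟨s, hs⟩
    have hmem : (⟨s, hs⟩ : unitInterval) ∈ Set.Ioc (t 0) (t n) := by
      rw [h0, h1]
      exact ⟨Subtype.mk_lt_mk.2 (lt_of_le_of_ne hs.1 hs0.symm), hs.2⟩
    rw [Set.indicator_of_mem hmem] at h
    rw [← h, hs2 hs, Finset.sum_apply]
    refine Finset.sum_congr rfl fun k _ => ?_
    rw [hs1 hs k]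
    rfl
  · rw [shiftInclusion_sum]
    exact Finset.sum_congr rfl fun k _ =>
      shiftInclusion_indicatorConstLp j hp (hA k) (hsub k) (hfin' k) (hfin k) _

/-- A predictable shift is almost surely the limit of shifts that are given by adapted
increments. -/
theorem IsPredictableShift.exists_approx [IsFiniteMeasure P] [Fact (1 ≤ p)] (j : X₀ →L[ℝ] H₀)
    (hp : 2 ≤ p) (hp' : p ≠ ∞) {h : Ω → ShiftSpace X₀ p} (hh : IsPredictableShift P ι h) :
    ∃ (t : ℕ → ℕ → ℝ) (N : ℕ → ℕ) (Φ : ℕ → ℕ → Ω → NoiseSpace H₀) (g : ℕ → Ω → ShiftSpace X₀ p),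
      (∀ n, IsAdaptedIncrements P ι (t n) (Φ n)) ∧ (∀ n, (Set.range (g n)).Finite) ∧
      (∀ n ω, shiftInclusion j hp (g n ω) = ∑ k ∈ Finset.range (N n), Φ n k ω) ∧
      ∀ᵐ ω ∂P, Tendsto (fun n => g n ω) atTop (𝓝 (h ω)) := by
  obtain ⟨u, hu, hhu⟩ := hh
  have hmp := unitInterval.measurePreserving_coe
  have hae : ∀ {q : ℝ → Prop}, (∀ᵐ s, q s) → ∀ᵐ s : unitInterval, q s := fun hq =>
    hmp.quasiMeasurePreserving.ae (ae_restrict_of_ae hq)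
  have hmem : ∀ᵐ ω ∂P, MemLp (fun s => u s ω) p (volume : Measure unitInterval) := by
    filter_upwards [hhu] with ω hω
    refine ((Lp.memLp (h ω)).comp_measurePreserving hmp).ae_eq ?_
    filter_upwards [hae hω] with s hs using hs s.2
  obtain ⟨D, v, hv, hlim⟩ :=
    exists_isStepProcess_tendsto_eLpNorm (Fact.out : 1 ≤ p) hp' volume P hu hmem
  choose t N Φ g hΦ hfin hg hsum using fun n => (hv n).exists_shift j hp
  refine ⟨t, N, Φ, g, hΦ, hfin, hsum, ?_⟩
  filter_upwards [hlim, hhu] with ω h1 h2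
  rw [Lp.tendsto_Lp_iff_tendsto_eLpNorm']
  refine h1.congr fun n => ?_
  rw [eLpNorm_sub_comm, ← eLpNorm_comp_measurePreserving
    ((Lp.aestronglyMeasurable _).sub (Lp.aestronglyMeasurable _)) hmp]
  refine eLpNorm_congr_ae ?_
  filter_upwards [hae h2, hae (hg n ω)] with s hs1 hs2
  simp [hs1 s.2, hs2 s.2]

end StepShift

/-! ### Uniform absolute continuity and limits of compositions -/

section UniformAbsoluteContinuity

/-- The laws of the maps `T n` under `P` are absolutely continuous with respect to `P`, uniformly
in `n`. -/
def UniformlyAbsolutelyContinuous {Ω α : Type*} [MeasurableSpace Ω] (P : Measure Ω)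
    (T : α → Ω → Ω) : Prop :=
  ∀ ε : ℝ≥0∞, ε ≠ 0 → ∃ δ : ℝ≥0∞, δ ≠ 0 ∧ ∀ A, MeasurableSet A → P A ≤ δ →
    ∀ n, P (T n ⁻¹' A) ≤ ε

variable {Ω α : Type*} [MeasurableSpace Ω] {P : Measure Ω} {T : ℕ → Ω → Ω} {S : Ω → Ω}

theorem UniformlyAbsolutelyContinuous.ae {T : α → Ω → Ω} (hT : UniformlyAbsolutelyContinuous P T)
    {q : Ω → Prop} (hq : ∀ᵐ ω ∂P, q ω) (n : α) : ∀ᵐ ω ∂P, q (T n ω) := by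
  obtain ⟨A, hsub, hA, hA0⟩ := exists_measurable_superset_of_null (ae_iff.1 hq)
  refine measure_mono_null (t := T n ⁻¹' A) (fun ω hω => hsub hω) ?_
  by_contra hne
  obtain ⟨δ, -, hδ⟩ := hT (P (T n ⁻¹' A) / 2) (by simpa using hne)
  by_cases htop : P (T n ⁻¹' A) = ∞
  · obtain ⟨δ, -, hδ⟩ := hT 1 one_ne_zero
    simpa [htop] using hδ A hA (by simp [hA0]) n
  · exact (ENNReal.half_lt_self hne htop).not_ge (hδ A hA (by simp [hA0]) n)

/-- Outer regularity replaces `A` by an open set `U` of measure below `δ`. If `S ω ∈ U`, then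
eventually `T n ω ∈ U`, so the measure of `S ⁻¹' U` is bounded by those of `T n ⁻¹' U`. -/
theorem UniformlyAbsolutelyContinuous.of_tendsto [TopologicalSpace Ω] [OpensMeasurableSpace Ω]
    [P.OuterRegular]
    (hT : UniformlyAbsolutelyContinuous P T)
    (hlim : ∀ᵐ ω ∂P, Tendsto (fun n => T n ω) atTop (𝓝 (S ω))) :
    UniformlyAbsolutelyContinuous P (fun _ : Unit => S) := by
  intro ε hε
  obtain ⟨δ, hδ0, hδ⟩ := hT ε hε
  obtain ⟨δ', hδ'0, hδ'⟩ := exists_between (pos_iff_ne_zero.2 hδ0)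
  refine ⟨δ', hδ'0.ne', fun A hA hPA _ => ?_⟩
  obtain ⟨U, hAU, hU, hPU⟩ := A.exists_isOpen_lt_of_lt δ (hPA.trans_lt hδ')
  have hmono : Monotone fun k => ⋂ n ≥ k, T n ⁻¹' U := fun a b hab =>
    Set.biInter_mono (fun n hn => le_trans hab hn) fun _ _ => le_rfl
  have hle : P (S ⁻¹' A) ≤ P (⋃ k, ⋂ n ≥ k, T n ⁻¹' U) := by
    refine measure_mono_ae ?_
    filter_upwards [hlim] with ω hω hωA
    obtain ⟨k, hk⟩ := eventually_atTop.1 (hω.eventually (hU.mem_nhds (hAU hωA)))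
    exact Set.mem_iUnion.2 ⟨k, Set.mem_iInter₂.2 hk⟩
  refine hle.trans ?_
  rw [hmono.measure_iUnion]
  refine iSup_le fun k => (measure_mono (Set.biInter_subset_of_mem le_rfl)).trans ?_
  exact hδ U hU.measurableSet hPU.le k

variable [PseudoMetricSpace Ω] [BorelSpace Ω] [IsFiniteMeasure P]

/-- Under uniform absolute continuity, composition with a bounded measurable function preserves
almost sure convergence, in the sense of convergence in measure. -/
theorem UniformlyAbsolutelyContinuous.tendstoInMeasure_comp
    (hT : UniformlyAbsolutelyContinuous P T) (hTm : ∀ n, Measurable (T n))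
    (hlim : ∀ᵐ ω ∂P, Tendsto (fun n => T n ω) atTop (𝓝 (S ω))) {ψ : Ω → ℝ}
    (hψ : Measurable ψ) {C : ℝ} (hC : ∀ ω, ‖ψ ω‖ ≤ C) :
    TendstoInMeasure P (fun n ω => ψ (T n ω)) atTop (fun ω => ψ (S ω)) := by
  rw [tendstoInMeasure_iff_norm]
  intro c hc
  rw [ENNReal.tendsto_nhds_zero]
  intro ε hε
  have hε3 : ε / 3 ≠ 0 := by simp [hε.ne']
  obtain ⟨δ, hδ0, hδ⟩ := hT (ε / 3) hε3
  obtain ⟨δ', hδ'0, hδ'⟩ := hT.of_tendsto hlim (ε / 3) hε3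
  have hc3 : ENNReal.ofReal (c / 3) ≠ 0 := by simpa using hc
  -- The L¹ accuracy is dictated by Markov's inequality: the set `A` where `ψ` and `f` differ by at
  -- least `c / 3` gets measure at most `min δ δ'`, so its preimages under `T n` and `S` have
  -- measure at most `ε / 3`.
  obtain ⟨f, hf, -⟩ := (MemLp.of_bound hψ.aestronglyMeasurable C
    (.of_forall hC) : MemLp ψ 1 P).exists_boundedContinuous_eLpNorm_sub_le (by simp)
    (ε := ENNReal.ofReal (c / 3) * min δ δ') (mul_ne_zero hc3 (by simp [hδ0, hδ'0]))
  let A : Set Ω := {ω | c / 3 ≤ ‖ψ ω - f ω‖}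
  have hsub : Measurable fun ω => ψ ω - f ω := hψ.sub f.continuous.measurable
  have hA : MeasurableSet A := measurableSet_le measurable_const hsub.norm
  have hPA : P A ≤ min δ δ' := by
    have h := mul_meas_ge_le_pow_eLpNorm' P one_ne_zero ENNReal.one_ne_top
      hsub.aestronglyMeasurable (ENNReal.ofReal (c / 3))
    simp only [ENNReal.toReal_one, ENNReal.rpow_one] at h
    have hAeq : {x | ENNReal.ofReal (c / 3) ≤ ‖ψ x - f x‖ₑ} = A := by
      ext ω
      simp only [A, ← ofReal_norm]
      exact ENNReal.ofReal_le_ofReal_iff (norm_nonneg _)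
    rw [hAeq] at h
    exact (ENNReal.mul_le_mul_iff_right hc3 ENNReal.ofReal_ne_top).1 (h.trans hf)
  have hflim : TendstoInMeasure P (fun n ω => f (T n ω)) atTop (fun ω => f (S ω)) := by
    refine tendstoInMeasure_of_tendsto_ae
      (fun n => (f.continuous.measurable.comp (hTm n)).aestronglyMeasurable) ?_
    filter_upwards [hlim] with ω hω using (f.continuous.tendsto _).comp hω
  have hev := (ENNReal.tendsto_nhds_zero.1 (tendstoInMeasure_iff_norm.1 hflim (c / 3)
    (by positivity))) (ε / 3) (pos_iff_ne_zero.2 hε3)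
  filter_upwards [hev] with n hn
  calc P {ω | c ≤ ‖ψ (T n ω) - ψ (S ω)‖}
      ≤ P ((T n ⁻¹' A ∪ S ⁻¹' A) ∪ {ω | c / 3 ≤ ‖f (T n ω) - f (S ω)‖}) := by
        refine measure_mono fun ω hω => ?_
        by_contra hcon
        simp only [A, Set.mem_union, Set.mem_preimage, Set.mem_ofPred_eq, not_or, not_le] at hcon hω
        obtain ⟨⟨h1, h2⟩, h3⟩ := hcon
        simp only [Real.norm_eq_abs, abs_lt] at h1 h2 h3
        refine hω.not_gt ?_
        rw [Real.norm_eq_abs, abs_lt]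
        constructor <;> linarith
    _ ≤ ε / 3 + ε / 3 + ε / 3 := by
        refine (measure_union_le _ _).trans (add_le_add ((measure_union_le _ _).trans
          (add_le_add ?_ ?_)) hn)
        · exact hδ A hA (hPA.trans (min_le_left _ _)) n
        · exact hδ' A hA (hPA.trans (min_le_right _ _)) ()
    _ = ε := ENNReal.add_thirds ε

/-- If the laws of `T n` are uniformly absolutely continuous, `T n → S` and `ξ ∘ T n → Y` almost
surely, then `ξ ∘ S = Y` almost surely. -/
theorem UniformlyAbsolutelyContinuous.comp_ae_eq {M : Type*} [MetricSpace M]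
    [TopologicalSpace.SeparableSpace M] [MeasurableSpace M] [BorelSpace M]
    (hT : UniformlyAbsolutelyContinuous P T) (hTm : ∀ n, Measurable (T n))
    (hlim : ∀ᵐ ω ∂P, Tendsto (fun n => T n ω) atTop (𝓝 (S ω))) {ξ Y : Ω → M}
    (hξ : AEMeasurable ξ P)
    (hY : ∀ᵐ ω ∂P, Tendsto (fun n => ξ (T n ω)) atTop (𝓝 (Y ω))) :
    ∀ᵐ ω ∂P, ξ (S ω) = Y ω := by
  obtain ⟨Q, hQc, hQ⟩ := TopologicalSpace.exists_countable_dense M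
  obtain ⟨ξ', hξ'm, hξ'⟩ := hξ
  have hTae := ae_all_iff.2 fun n => hT.ae hξ' n
  have hSae := (hT.of_tendsto hlim).ae hξ' ()
  -- Truncated distances to a countable dense set separate points; each one composed with `ξ ∘ T n`
  -- has two limits in measure, which must agree.
  have hφ : ∀ x ∈ Q, ∀ᵐ ω ∂P, min 1 (dist x (ξ (S ω))) = min 1 (dist x (Y ω)) := by
    intro x _
    have hcont : Continuous fun y : M => min 1 (dist x y) := by fun_prop
    have hψ : Measurable fun ω => min 1 (dist x (ξ' ω)) := hcont.measurable.comp hξ'm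
    have h1 := hT.tendstoInMeasure_comp hTm hlim hψ (C := 1) fun ω => by
      rw [Real.norm_of_nonneg (by positivity)]
      exact min_le_left _ _
    have h2 : TendstoInMeasure P (fun n ω => min 1 (dist x (ξ' (T n ω)))) atTop
        (fun ω => min 1 (dist x (Y ω))) := by
      refine tendstoInMeasure_of_tendsto_ae
        (fun n => (hψ.comp (hTm n)).aestronglyMeasurable) ?_
      filter_upwards [hY, hTae] with ω hω hω'
      simp_rw [← hω']
      exact (hcont.tendsto _).comp hω
    filter_upwards [tendstoInMeasure_ae_unique h1 h2, hSae] with ω h3 h4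
    rw [h4]
    exact h3
  filter_upwards [(ae_ball_iff hQc).2 hφ] with ω hω
  refine dist_le_zero.1 (le_of_forall_pos_le_add fun ε hε => ?_)
  -- Choosing `x` within distance one of `Y ω` makes the truncation inactive.
  obtain ⟨x, hxQ, hx⟩ := hQ.exists_dist_lt (Y ω) (by positivity : 0 < min 1 (ε / 2))
  have h := hω x hxQ
  rw [dist_comm] at hx
  have hx1 := hx.trans_le (min_le_left _ _)
  rw [min_eq_right hx1.le] at h
  have h' : dist x (ξ (S ω)) = dist x (Y ω) := by
    rcases min_cases (1 : ℝ) (dist x (ξ (S ω))) with h3 | h3 <;> linarith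
  have := dist_triangle_left (ξ (S ω)) (Y ω) x
  have := hx.trans_le (min_le_right _ _)
  linarith

end UniformAbsoluteContinuity

/-! ### Tightness and uniform absolute continuity of the shifts -/

section Tightness

/-- A sequence of random variables that is almost surely bounded is tight. -/
theorem exists_nat_forall_measure_lt_le {Ω : Type*} [MeasurableSpace Ω] {P : Measure Ω}
    [IsFiniteMeasure P] {X : ℕ → Ω → ℝ} (hX : ∀ n, Measurable (X n))
    (hbdd : ∀ᵐ ω ∂P, BddAbove (Set.range fun n => X n ω)) {ε : ℝ≥0∞} (hε : ε ≠ 0) :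
    ∃ N : ℕ, ∀ n, P {ω | N < X n ω} ≤ ε := by
  let A : ℕ → Set Ω := fun N => ⋃ n, {ω | N < X n ω}
  have hA : ∀ N, MeasurableSet (A N) := fun N =>
    .iUnion fun n => measurableSet_lt measurable_const (hX n)
  have hanti : Antitone A := fun a b hab => Set.iUnion_mono fun n ω hω =>
    lt_of_le_of_lt (by exact_mod_cast hab) (show (b : ℝ) < X n ω from hω)
  have hnull : P (⋂ N, A N) = 0 := by
    refine measure_mono_null (fun ω hω => ?_) (ae_iff.1 hbdd)
    rintro ⟨C, hC⟩
    obtain ⟨N, hN⟩ := exists_nat_ge C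
    obtain ⟨n, hn⟩ := Set.mem_iUnion.1 (Set.mem_iInter.1 hω N)
    have hn : (N : ℝ) < X n ω := hn
    exact (hn.trans_le (hC ⟨n, rfl⟩)).not_ge hN
  have hlim := tendsto_measure_iInter_atTop (μ := P) (fun N => (hA N).nullMeasurableSet) hanti
    ⟨0, measure_ne_top _ _⟩
  rw [hnull] at hlim
  obtain ⟨N, hN⟩ := ((ENNReal.tendsto_nhds_zero.1 hlim) ε (pos_iff_ne_zero.2 hε)).exists
  exact ⟨N, fun n => (measure_mono (Set.subset_iUnion (fun n => {ω | N < X n ω}) n)).trans hN⟩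

variable {Ω : Type*} [NormedAddCommGroup Ω] [NormedSpace ℝ Ω] [MeasurableSpace Ω]
  {H₀ : Type*} [NormedAddCommGroup H₀] [InnerProductSpace ℝ H₀] [CompleteSpace H₀]
  {P : Measure Ω} {ι : NoiseSpace H₀ →L[ℝ] Ω}
  [BorelSpace Ω] [CompleteSpace Ω] [TopologicalSpace.SeparableSpace Ω]

/-- Almost surely bounded sequences of shifts by adapted increments have uniformly absolutely
continuous laws. -/
theorem uniformlyAbsolutelyContinuous_shift (hι : IsCameronMartinInclusion P ι)
    {t : ℕ → ℕ → ℝ} {N : ℕ → ℕ} {Φ : ℕ → ℕ → Ω → NoiseSpace H₀}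
    (hΦ : ∀ n, IsAdaptedIncrements P ι (t n) (Φ n))
    (hbdd : ∀ᵐ ω ∂P, BddAbove (Set.range fun n => ‖∑ k ∈ Finset.range (N n), Φ n k ω‖ ^ 2)) :
    UniformlyAbsolutelyContinuous P
      (fun n ω => ω + ι (∑ k ∈ Finset.range (N n), Φ n k ω)) := by
  have := hι.isGaussian
  intro ε hε
  have hm : ∀ n, Measurable fun ω => ‖∑ k ∈ Finset.range (N n), Φ n k ω‖ ^ 2 := fun n => by
    simp_rw [(hΦ n).norm_sum_sq]
    exact Finset.measurable_fun_sum _ fun k _ =>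
      (hΦ n).measurable_apply k (g := fun a _ => ‖a‖ ^ 2) fun a => measurable_const
  obtain ⟨K, hK⟩ := exists_nat_forall_measure_lt_le hm hbdd (ε := ε / 2) (by simpa using hε)
  let c := ENNReal.ofReal (Real.exp (K / 2))
  have hc : c ≠ ∞ := ENNReal.ofReal_ne_top
  -- This `δ` solves c δ^(1/2) = ε/2; the other half of `ε` pays for the truncation.
  refine ⟨(ε / 2 / c) ^ (2 : ℝ), ?_, fun A hA hPA n => ?_⟩
  · simp [hε, hc]
  · refine ((hΦ n).measure_shift_le hι (N n) (Nat.cast_nonneg K) hA).trans ?_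
    refine (add_le_add (mul_le_mul_right (ENNReal.rpow_le_rpow hPA (by norm_num)) c)
      (hK n)).trans ?_
    rw [← ENNReal.rpow_mul]
    norm_num
    exact (add_le_add ENNReal.mul_div_le le_rfl).trans_eq (ENNReal.add_halves ε)

end Tightness

end

/-! ### Conclusion: passage to the limit -/

theorem mainTheorem8
    {Ω : Type*} [NormedAddCommGroup Ω] [NormedSpace ℝ Ω] [CompleteSpace Ω]
    [TopologicalSpace.SeparableSpace Ω] [MeasurableSpace Ω] [BorelSpace Ω]
    {H₀ : Type*} [NormedAddCommGroup H₀] [InnerProductSpace ℝ H₀] [CompleteSpace H₀]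
    (P : Measure Ω) (ι : NoiseSpace H₀ →L[ℝ] Ω) (hι : IsCameronMartinInclusion P ι)
    {X₀ : Type*} [NormedAddCommGroup X₀] [NormedSpace ℝ X₀] [CompleteSpace X₀]
    [TopologicalSpace.SeparableSpace X₀]
    (j : X₀ →L[ℝ] H₀) (hj : Function.Injective j)
    (p : ℝ≥0∞) [Fact (1 ≤ p)] (hp : 2 < p) (hp' : p < ∞)
    {M : Type*} [MetricSpace M] [CompleteSpace M] [TopologicalSpace.SeparableSpace M]
    [MeasurableSpace M] [BorelSpace M]
    (ξ : Ω → M) (hξ : AEMeasurable ξ P)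
    [AddAction (ShiftSpace X₀ p) M] [ContinuousVAdd (ShiftSpace X₀ p) M]
    (hshift : ∀ h : ShiftSpace X₀ p,
      ∀ᵐ ω ∂P, ξ (ω + ι (shiftInclusion j hp.le h)) = h +ᵥ ξ ω)
    (h : Ω → ShiftSpace X₀ p) (hpred : IsPredictableShift P ι h)
    (hexp : Integrable (fun ω => Real.exp (6 * ‖shiftInclusion j hp.le (h ω)‖ ^ 2)) P) :
    ∀ᵐ ω ∂P, ξ (ω + ι (shiftInclusion j hp.le (h ω))) = h ω +ᵥ ξ ω := by
  have := hι.isGaussian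
  have : SecondCountableTopology Ω := UniformSpace.secondCountable_of_separable Ω
  obtain ⟨t, N, Φ, g, hΦ, hfin, hsum, hlim⟩ := hpred.exists_approx j hp.le hp'.ne
  have hH : ∀ᵐ ω ∂P, Tendsto (fun n => ∑ k ∈ Finset.range (N n), Φ n k ω) atTop
      (𝓝 (shiftInclusion j hp.le (h ω))) := by
    filter_upwards [hlim] with ω hω
    simp_rw [← hsum]
    exact ((continuous_shiftInclusion j hp.le).tendsto _).comp hω
  have huac := uniformlyAbsolutelyContinuous_shift hι hΦ (N := N) (by
    filter_upwards [hH] with ω hω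
    exact (hω.norm.pow 2).bddAbove_range)
  refine huac.comp_ae_eq (fun n => ?_) ?_ hξ ?_
  · simp only [map_sum]
    exact measurable_id.add (Finset.measurable_fun_sum _ fun k _ =>
      (hΦ n).measurable_apply k (g := fun a _ => ι a) fun a => measurable_const)
  · filter_upwards [hH] with ω hω
    exact ((ι.continuous.tendsto _).comp hω).const_add ω
  -- All values of all the `g n` form a countable set, so one null set serves them all and the
  -- random value `g n ω` may be substituted.
  · have hg : ∀ᵐ ω ∂P, ∀ n, ∀ e ∈ Set.range (g n),
        ξ (ω + ι (shiftInclusion j hp.le e)) = e +ᵥ ξ ω :=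
      ae_all_iff.2 fun n => (ae_ball_iff (hfin n).countable).2 fun e _ => hshift e
    filter_upwards [hlim, hg] with ω h1 h2
    refine (h1.vadd tendsto_const_nhds).congr fun n => ?_
    rw [← hsum, h2 n _ ⟨ω, rfl⟩]
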